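/- **Setting.** Let $G=\mathrm{PSL}(2,\mathbb R)$ act on $\mathbb H^2=\{z\in\mathbb C : \mathrm{Im}\,z>0\}$ (coordinates $x_1=\mathrm{Re}\,z$, $x_2=\mathrm{Im}\,z$) by Möbius transformations, and let $H$ be the stabiliser of $i$. It consists of the classes $h_u$ of the matrices $\begin{pmatrix}\cos\frac u2&\sin\frac u2\\-\sin\frac u2&\cos\frac u2\end{pmatrix}$, and $\sigma:H\to S^1$, $\sigma(h_u)=e^{iu}$, is an isomorphism. Let $\mathrm{PU}(2)=\mathrm{SU}(2)/\{\pm I\}$, let $\theta_1:S^1\to\mathrm{PU}(2)$, $\theta_1(e^{iu})=[\mathrm{diag}(e^{iu/2},e^{-iu/2})]$, and put $\chi=\theta_1\circ\sigma:H\to\mathrm{PU}(2)$. Consider the basis $$b_1=\tfrac12\begin{pmatrix}0&1\\1&0\end{pmatrix},\quad b_2=\tfrac12\begin{pmatrix}1&0\\0&-1\end{pmatrix},\quad b_3=\tfrac12\begin{pmatrix}0&1\\-1&0\end{pmatrix}$$ of $\mathfrak{sl}(2,\mathbb R)=\mathfrak s\oplus\mathfrak h$, where $\mathfrak s=\langle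 b_1,b_2\rangle$ and $\mathfrak h=\mathbb R b_3$ is the Lie algebra of $H$, and the basis $$a_1=\tfrac12\begin{pmatrix}0&i\\i&0\end{pmatrix},\quad a_2=\tfrac12\begin{pmatrix}0&-1\\1&0\end{pmatrix},\quad a_3=\tfrac12\begin{pmatrix}i&0\\0&-i\end{pmatrix}$$ of $\mathfrak{su}(2)$. Let $\mu_0:\mathfrak s\to\mathfrak{su}(2)$, $\mu_0(u_1b_1+u_2b_2)=u_1a_2-u_2a_1$. Let $P_\chi=G\times_\chi\mathrm{PU}(2)$ be the quotient of $G\times\mathrm{PU}(2)$ by $(g,k)\sim(gh,\chi(h)^{-1}k)$, $h\in H$; it is a principal $\mathrm{PU}(2)$-bundle over $\mathbb H^2$ with projection $[g,k]\mapsto g\cdot i$ and right action $[g,k]k'=[g,kk']$. For $s\in\mathbb R$ let $A_{\chi,s\mu_0}$ be the $G$-invariant connection on $P_\chi$ whose connection form has the pull-back $$\mathrm{ad}_{k^{-1}}\,\lambda_s(g^{-1}dg)+k^{-1}dk,\qquad \lambda_s|_{\mathfrak h}=\chi_*\ (\text{so }\lambda_s(b_3)=a_3),\quad \lambda_s|_{\mathfrak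 s}=s\mu_0,$$ to $G\times\mathrm{PU}(2)$. Let $\mathbb H^3=\{x\in\mathbb R^3 : x_3>0\}$ with the metric $x_3^{-2}(dx_1^2+dx_2^2+dx_3^2)$ and the standard orientation. Let $\mathrm{SO}(\mathbb H^3)$ be its principal $\mathrm{SO}(3)$-bundle of oriented orthonormal frames, and $B_{\mathrm{LC}}$ its Levi-Civita connection. For $t\in\mathbb R$ let $$\varphi_t:\mathbb H^2\to\mathbb H^3,\qquad \varphi_t(x_1,x_2)=\Bigl(x_2\tanh t,\;x_1,\;\frac{x_2}{\cosh t}\Bigr),$$ an embedding whose image $H_t$ is the surface $x_1=\sinh(t)\,x_3$ in $\mathbb H^3$. Identify $\mathrm{PU}(2)$ with $\mathrm{SO}(3)$ by the isomorphism $\mathrm{Ad}:\mathrm{PU}(2)\to\mathrm{SO}(\mathfrak{su}(2))=\mathrm{SO}(3)$ given by the adjoint action and the basis $(a_1,a_2,a_3)$, and $\mathfrak{su}(2)$ with $\mathfrak{so}(3)$ by its differential. **Proposition.** For every $t\in\mathbb R$ there is a natural isomorphism of pairs $$\bigl(P_\chi,\;A_{\chi,\sinh(t)\mu_0}\bigr)\;\simeq\;\bigl(\varphi_t^*(\mathrm{SO}(\mathbb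 H^3)),\;\varphi_t^*(B_{\mathrm{LC}})\bigr).$$ Precisely, there is a diffeomorphism $\Phi:P_\chi\to\varphi_t^*(\mathrm{SO}(\mathbb H^3))$ covering $\mathrm{id}_{\mathbb H^2}$ such that $\Phi(yk)=\Phi(y)\,\mathrm{Ad}(k)$ for all $y\in P_\chi$, $k\in\mathrm{PU}(2)$, such that $\Phi^*(\varphi_t^*B_{\mathrm{LC}})=A_{\chi,\sinh(t)\mu_0}$ under $\mathfrak{su}(2)\simeq\mathfrak{so}(3)$, and such that, for every $g\in G$, the first two vectors of the frame $\Phi([g,1])$, which lies over $g\cdot i$, are $$\frac1{\cosh t}\,d(\varphi_t\circ g)_i(e_1),\qquad \frac1{\cosh t}\,d(\varphi_t\circ g)_i(e_2),$$ where $e_1=1$, $e_2=i$ is the standard basis of $T_i\mathbb H^2=\mathbb C$. (The third vector is then the positive unit normal of $H_t$.) -/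

import Mathlib

open Matrix Diffeology
open scoped ContDiff MatrixGroups Topology Matrix.Norms.L2Operator

-- `Matrix.Norms.L2Operator` makes the matrix spaces normed real algebras; which norm is used is
-- irrelevant for smoothness and for derivatives.

noncomputable section

namespace HypConn

/-! ### Smooth structures and differential forms, via plots -/

/-- The real vector space of `n`-tuples, as the domain of plots. -/
abbrev E (n : ℕ) : Type := EuclideanSpace ℝ (Fin n)

/-- A smooth map of `E n` to itself which is the identity near `x` and has values in a given
neighbourhood of `x`. -/
theorem exists_cutoff {n : ℕ} (x : E n) {u : Set (E n)} (hu : IsOpen u) (hx : x ∈ u) :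
    ∃ f : E n → E n, ContDiff ℝ ∞ f ∧ (∀ y, f y ∈ u) ∧ ∀ᶠ y in 𝓝 x, f y = y := by
  obtain ⟨r, hr, hru⟩ := Metric.isOpen_iff.1 hu x hx
  let b : ContDiffBump x := ⟨r / 2, r, by positivity, by linarith⟩
  refine ⟨fun y => x + b y • (y - x), ?_, fun y => hru ?_, ?_⟩
  · exact contDiff_const.add (b.contDiff.smul (contDiff_id.sub contDiff_const))
  · by_cases hy : dist y x < r
    · rw [Metric.mem_ball, dist_eq_norm, add_sub_cancel_left, norm_smul]
      rw [dist_eq_norm] at hy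
      refine lt_of_le_of_lt ?_ hy
      rw [Real.norm_eq_abs, abs_of_nonneg b.nonneg]
      exact mul_le_of_le_one_left (norm_nonneg _) b.le_one
    · have h0 : b y = 0 := b.zero_of_le_dist (not_lt.1 hy)
      simpa [h0] using hr
  · filter_upwards [b.eventuallyEq_one] with y hy
    simp [hy]

/-- The smooth structure of a subset of a normed space (or of anything with an injection `ι` into
a normed space): a map into it is smooth if it is smooth as a map into the normed space. On an
embedded submanifold this is the manifold structure. -/
@[reducible]
def embeddedDiffeology {X V : Type*} [NormedAddCommGroup V] [NormedSpace ℝ V] (ι : X → V) :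
    DiffeologicalSpace X where
  plots n := {p : E n → X | ContDiff ℝ ∞ (fun x => ι (p x))}
  constant_plots {n} x := (contDiff_const : ContDiff ℝ ∞ (fun _ : E n => ι x))
  plot_reparam {n m p f} hp hf :=
    (ContDiff.comp (g := fun x => ι (p x)) hp hf : ContDiff ℝ ∞ (fun x => ι ((p ∘ f) x)))
  locality {n p} h := by
    change ContDiff ℝ ∞ (fun x => ι (p x))
    refine contDiff_iff_contDiffAt.2 fun x => ?_
    obtain ⟨u, hu, hx, h⟩ := h x
    obtain ⟨f, hf, hfu, hfx⟩ := exists_cutoff x hu hx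
    have h' : ContDiff ℝ ∞ (fun y => ι ((p ∘ f) y)) := h hfu hf
    refine h'.contDiffAt.congr_of_eventuallyEq ?_
    filter_upwards [hfx] with y hy
    simp [hy]

/-- The quotient smooth structure along a surjection `q : X → Y`: a map into `Y` is smooth if it
lifts locally to a smooth map into `X`. If `q` is a surjective submersion of manifolds, this is
the manifold structure of `Y`. -/
@[reducible]
def quotientDiffeology {X Y : Type*} [DiffeologicalSpace X] (q : X → Y)
    (hq : Function.Surjective q) : DiffeologicalSpace Y where
  plots n := {p : E n → Y | ∀ x, ∃ p' : E n → X, IsPlot p' ∧ ∀ᶠ y in 𝓝 x, q (p' y) = p y}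
  constant_plots y x := by
    obtain ⟨a, rfl⟩ := hq y
    exact ⟨fun _ => a, isPlot_const, by simp⟩
  plot_reparam {n m p f} hp hf x := by
    obtain ⟨p', hp', h⟩ := hp (f x)
    exact ⟨p' ∘ f, isPlot_reparam hp' hf, hf.continuous.continuousAt.eventually h⟩
  locality {n p} h x := by
    obtain ⟨u, hu, hx, h⟩ := h x
    obtain ⟨f, hf, hfu, hfx⟩ := exists_cutoff x hu hx
    obtain ⟨p', hp', h'⟩ := h hfu hf x
    refine ⟨p', hp', ?_⟩
    filter_upwards [h', hfx] with y hy hy'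
    rw [hy, Function.comp_apply, hy']

/-- A smooth `V`-valued differential 1-form on `X`: for every smooth map `p : E n → X` a smooth
1-form on `E n` (its pull-back by `p`), compatibly with reparametrisation. On a manifold these
are the usual 1-forms. -/
@[ext]
structure OneForm (X : Type*) [DiffeologicalSpace X] (V : Type*) [NormedAddCommGroup V]
    [NormedSpace ℝ V] where
  /-- the pull-back of the form by a plot -/
  toFun : ∀ {n : ℕ} (p : E n → X), IsPlot p → E n → (E n →L[ℝ] V)
  smooth : ∀ {n : ℕ} (p : E n → X) (hp : IsPlot p), ContDiff ℝ ∞ (toFun p hp)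
  reparam : ∀ {n m : ℕ} (p : E m → X) (hp : IsPlot p) (f : E n → E m) (hf : ContDiff ℝ ∞ f)
    (x : E n), toFun (p ∘ f) (isPlot_reparam hp hf) x = (toFun p hp (f x)).comp (fderiv ℝ f x)

section OneForm

variable {X V W : Type*} [DiffeologicalSpace X] [NormedAddCommGroup V]
  [NormedSpace ℝ V] [NormedAddCommGroup W] [NormedSpace ℝ W]

/-- The pull-back `f^* η` of a 1-form. -/
def OneForm.pullback {Y : Type*} [DiffeologicalSpace Y] (η : OneForm Y V) (f : X → Y) (hf : DSmooth f) : OneForm X V where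
  toFun p hp := η.toFun (f ∘ p) (hf _ p hp)
  smooth _ _ := η.smooth _ _
  reparam p hp g hg x := η.reparam (f ∘ p) (hf _ p hp) g hg x

/-- The 1-form `L ∘ η`, for a linear map `L` between the value spaces. -/
def OneForm.map (η : OneForm X V) (L : V →L[ℝ] W) : OneForm X W where
  toFun p hp x := L.comp (η.toFun p hp x)
  smooth p hp := contDiff_const.clm_comp (η.smooth p hp)
  reparam p hp g hg x := by rw [η.reparam p hp g hg x, ContinuousLinearMap.comp_assoc]

/-- A 1-form on `X` that takes the same value on any two lifts of the same plot of `Y` descends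
along `q : X → Y`: its value on a plot is its value on any local lift. -/
def OneForm.descend {Y : Type*} (q : X → Y) (hq : Function.Surjective q) (η : OneForm X V)
    (h : ∀ {n : ℕ} (p p' : E n → X) (hp : IsPlot p) (hp' : IsPlot p') (x : E n),
      (∀ᶠ y in 𝓝 x, q (p y) = q (p' y)) → η.toFun p hp x = η.toFun p' hp' x) :
    letI := quotientDiffeology q hq
    OneForm Y V :=
  letI := quotientDiffeology q hq
  { toFun := fun p hp x => η.toFun (hp x).choose (hp x).choose_spec.1 x
    smooth := fun p hp => by
      refine contDiff_iff_contDiffAt.2 fun x => ?_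
      refine (η.smooth _ (hp x).choose_spec.1).contDiffAt.congr_of_eventuallyEq ?_
      filter_upwards [(hp x).choose_spec.2.eventually_nhds] with y hy
      refine h _ _ _ _ y ?_
      filter_upwards [(hp y).choose_spec.2, hy] with z hz hz'
      rw [hz, hz']
    reparam := fun p hp f hf x => by
      rw [← η.reparam _ _ f hf x]
      refine h _ _ _ _ x ?_
      filter_upwards [((isPlot_reparam hp hf : IsPlot (p ∘ f)) x).choose_spec.2,
        hf.continuous.continuousAt.eventually (hp (f x)).choose_spec.2] with y hy hy'
      rw [hy, Function.comp_apply, Function.comp_apply, hy'] }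

/-- The quotient map is smooth for the quotient smooth structure. -/
theorem dSmooth_quotient {Y : Type*} (q : X → Y) (hq : Function.Surjective q) :
    letI := quotientDiffeology q hq
    DSmooth q :=
  fun _ p hp _ => ⟨p, hp, Filter.Eventually.of_forall fun _ => rfl⟩

theorem OneForm.pullback_descend {Y : Type*} (q : X → Y) (hq : Function.Surjective q) (η : OneForm X V)
    (h : ∀ {n : ℕ} (p p' : E n → X) (hp : IsPlot p) (hp' : IsPlot p') (x : E n),
      (∀ᶠ y in 𝓝 x, q (p y) = q (p' y)) → η.toFun p hp x = η.toFun p' hp' x) :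
    letI := quotientDiffeology q hq
    (OneForm.descend q hq η h).pullback q (dSmooth_quotient q hq) = η := by
  letI := quotientDiffeology q hq
  refine OneForm.ext ?_
  funext n p hp x
  have hqp := dSmooth_quotient q hq n p hp
  exact h _ _ _ _ x (hqp x).choose_spec.2

end OneForm

/-! ### The hyperbolic plane as a homogeneous space of `PSL(2, ℝ)` -/

/-- The action of `PSL(2, ℝ)` on the upper half plane by Möbius transformations. -/
def moebius : PSL(2, ℝ) →* Equiv.Perm UpperHalfPlane :=
  QuotientGroup.lift _ (MulAction.toPermHom SL(2, ℝ) UpperHalfPlane) (by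
    intro A hA
    obtain ⟨r, hr, h⟩ := Matrix.SpecialLinearGroup.mem_center_iff.1 hA
    have hr' : r ≠ 0 := by
      rintro rfl
      simp at hr
    refine Equiv.ext fun z => ?_
    refine UpperHalfPlane.ext ?_
    have hc : (r : ℂ) ≠ 0 := by exact_mod_cast hr'
    simp only [MulAction.toPermHom_apply, MulAction.toPerm_apply,
      UpperHalfPlane.coe_specialLinearGroup_apply, ← h]
    simp [Matrix.scalar_apply, hc])

/-- The stabiliser `H` of the base point `i` in `PSL(2, ℝ)`. -/
def stab : Subgroup PSL(2, ℝ) :=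
  (MulAction.stabilizer (Equiv.Perm UpperHalfPlane) UpperHalfPlane.I).comap moebius

theorem mk_mem_stab_iff (A : SL(2, ℝ)) :
    (QuotientGroup.mk A : PSL(2, ℝ)) ∈ stab ↔ A 1 0 = - A 0 1 ∧ A 1 1 = A 0 0 := by
  have h1 : (QuotientGroup.mk A : PSL(2, ℝ)) ∈ stab ↔ A • UpperHalfPlane.I = UpperHalfPlane.I :=
    Iff.rfl
  have hne : (A 1 0 : ℂ) * Complex.I + A 1 1 ≠ 0 := by
    intro h
    have h2 := congrArg Complex.re h
    have h3 := congrArg Complex.im h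
    simp at h2 h3
    have := A.det_coe
    rw [Matrix.det_fin_two, h2, h3] at this
    simp at this
  rw [h1, UpperHalfPlane.ext_iff, UpperHalfPlane.coe_specialLinearGroup_apply]
  simp only [UpperHalfPlane.coe_I, Algebra.algebraMap_self, RingHom.id_apply]
  rw [div_eq_iff hne, Complex.ext_iff]
  simp
  constructor
  · rintro ⟨h, h'⟩; constructor <;> linarith
  · rintro ⟨h, h'⟩; constructor <;> linarith

theorem stab_sq {A : SL(2, ℝ)} (h : (QuotientGroup.mk A : PSL(2, ℝ)) ∈ stab) :
    A 0 0 ^ 2 + A 0 1 ^ 2 = 1 := by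
  obtain ⟨h1, h2⟩ := (mk_mem_stab_iff A).1 h
  have := A.det_coe
  rw [Matrix.det_fin_two, h1, h2] at this
  linarith

/-- The function `[A] ↦ (A₀₀ + i A₀₁)²` on `PSL(2, ℝ)`. -/
def sigmaFun : PSL(2, ℝ) → ℂ :=
  Quotient.lift (fun A : SL(2, ℝ) => ((A 0 0 : ℂ) + A 0 1 * Complex.I) ^ 2) (by
    intro A B hAB
    have hAB : A⁻¹ * B ∈ Subgroup.center SL(2, ℝ) := QuotientGroup.leftRel_apply.1 hAB
    obtain ⟨r, hr, h⟩ := Matrix.SpecialLinearGroup.mem_center_iff.1 hAB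
    have hB : (B : Matrix (Fin 2) (Fin 2) ℝ) = (A : Matrix (Fin 2) (Fin 2) ℝ) * scalar (Fin 2) r := by
      rw [h, ← Matrix.SpecialLinearGroup.coe_mul]; simp
    have hr : (r : ℂ) ^ 2 = 1 := by exact_mod_cast (by simpa using hr)
    simp only [hB]
    simp [Matrix.mul_apply, Matrix.scalar_apply, Fin.sum_univ_two]
    linear_combination (-((A 0 0 : ℂ) + A 0 1 * Complex.I) ^ 2) * hr)

theorem sigmaFun_mk (A : SL(2, ℝ)) :
    sigmaFun (QuotientGroup.mk A) = ((A 0 0 : ℂ) + A 0 1 * Complex.I) ^ 2 := rfl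

theorem norm_sigmaFun {g : PSL(2, ℝ)} (hg : g ∈ stab) : ‖sigmaFun g‖ = 1 := by
  induction g using QuotientGroup.induction_on with
  | H A =>
    have h := stab_sq hg
    rw [sigmaFun_mk, norm_pow, ← Complex.normSq_eq_norm_sq, Complex.normSq_add_mul_I, h]

/-- The isomorphism `σ : H → S¹`, which maps the class `h_t` of the matrix with rows
`(cos (t/2), sin (t/2))` and `(-sin (t/2), cos (t/2))` to `e^{it}`, see `sigma_rot`. -/
def sigma : stab →* Circle where
  toFun h := ⟨sigmaFun h, mem_sphere_zero_iff_norm.2 (norm_sigmaFun h.2)⟩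
  map_one' := by
    refine Circle.ext ?_
    change sigmaFun (QuotientGroup.mk 1) = 1
    rw [sigmaFun_mk]
    simp
  map_mul' := by
    rintro ⟨g, hg⟩ ⟨g', hg'⟩
    refine Circle.ext ?_
    change sigmaFun (g * g') = sigmaFun g * sigmaFun g'
    induction g using QuotientGroup.induction_on with
    | H A =>
    induction g' using QuotientGroup.induction_on with
    | H B =>
      obtain ⟨h1, h2⟩ := (mk_mem_stab_iff A).1 hg
      obtain ⟨h3, h4⟩ := (mk_mem_stab_iff B).1 hg'
      rw [← QuotientGroup.mk_mul, sigmaFun_mk, sigmaFun_mk, sigmaFun_mk]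
      simp only [Matrix.SpecialLinearGroup.coe_mul, Matrix.mul_apply, Fin.sum_univ_two, h3, h4]
      push_cast
      rw [← mul_pow]
      congr 1
      linear_combination (-(A 0 1 : ℂ) * B 0 1) * Complex.I_sq

theorem coe_sigma (h : stab) : (sigma h : ℂ) = sigmaFun h := rfl

/-- The rotation matrix with rows `(cos (t/2), sin (t/2))` and `(-sin (t/2), cos (t/2))`. -/
def rot (t : ℝ) : SL(2, ℝ) :=
  ⟨!![Real.cos (t / 2), Real.sin (t / 2); -Real.sin (t / 2), Real.cos (t / 2)], by
    rw [Matrix.det_fin_two_of]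
    nlinarith [Real.sin_sq_add_cos_sq (t / 2)]⟩

theorem rot_mem (t : ℝ) : (QuotientGroup.mk (rot t) : PSL(2, ℝ)) ∈ stab :=
  (mk_mem_stab_iff _).2 ⟨rfl, rfl⟩

theorem sigma_rot (t : ℝ) : sigma ⟨QuotientGroup.mk (rot t), rot_mem t⟩ = Circle.exp t := by
  refine Circle.ext ?_
  rw [coe_sigma, Circle.coe_exp]
  change sigmaFun (QuotientGroup.mk (rot t)) = _
  rw [sigmaFun_mk]
  change ((Real.cos (t / 2) : ℂ) + Real.sin (t / 2) * Complex.I) ^ 2 = _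
  have : (t : ℂ) * Complex.I = 2 * ((t / 2 : ℝ) * Complex.I) := by push_cast; ring
  rw [this, two_mul, Complex.exp_add, Complex.exp_mul_I, ← sq]
  simp

/-! ### The structure group `PU(2)` and the isomorphism `PU(2) ≃ SO(3)` -/

/-- The group `SU(2)`. -/
abbrev SU2 : Type := Matrix.specialUnitaryGroup (Fin 2) ℂ

theorem SU2.mul_star (U : SU2) : (U : Matrix (Fin 2) (Fin 2) ℂ) * star (U : Matrix (Fin 2) (Fin 2) ℂ) = 1 :=
  Matrix.mem_unitaryGroup_iff.1 U.2.1

theorem SU2.star_mul (U : SU2) : star (U : Matrix (Fin 2) (Fin 2) ℂ) * (U : Matrix (Fin 2) (Fin 2) ℂ) = 1 :=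
  Matrix.mem_unitaryGroup_iff'.1 U.2.1

/-- The subgroup `{I, -I}` of `SU(2)`. -/
def signs : Subgroup SU2 where
  carrier := {U | (U : Matrix (Fin 2) (Fin 2) ℂ) = 1 ∨ (U : Matrix (Fin 2) (Fin 2) ℂ) = -1}
  one_mem' := Or.inl rfl
  mul_mem' := by
    intro U V hU hV
    change (U : Matrix (Fin 2) (Fin 2) ℂ) * V = 1 ∨ (U : Matrix (Fin 2) (Fin 2) ℂ) * V = -1
    rcases hU with h | h <;> rcases hV with h' | h' <;> rw [h, h'] <;> simp
  inv_mem' := by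
    rintro U (h | h)
    · left
      change star (U : Matrix (Fin 2) (Fin 2) ℂ) = 1
      simp [h]
    · right
      change star (U : Matrix (Fin 2) (Fin 2) ℂ) = -1
      simp [h]

instance : signs.Normal where
  conj_mem := by
    rintro U (h | h) V
    · left
      change (V : Matrix (Fin 2) (Fin 2) ℂ) * U * star (V : Matrix (Fin 2) (Fin 2) ℂ) = 1
      rw [h, mul_one, SU2.mul_star]
    · right
      change (V : Matrix (Fin 2) (Fin 2) ℂ) * U * star (V : Matrix (Fin 2) (Fin 2) ℂ) = -1
      rw [h, mul_neg, mul_one, neg_mul, SU2.mul_star]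

/-- The group `PU(2) = SU(2)/{±I}`. -/
abbrev PU2 : Type := SU2 ⧸ signs

theorem PU2.mk_eq_iff (U V : SU2) : (QuotientGroup.mk U : PU2) = QuotientGroup.mk V ↔
    (V : Matrix (Fin 2) (Fin 2) ℂ) = U ∨ (V : Matrix (Fin 2) (Fin 2) ℂ) = -(U : Matrix (Fin 2) (Fin 2) ℂ) := by
  rw [QuotientGroup.eq]
  change star (U : Matrix (Fin 2) (Fin 2) ℂ) * V = 1 ∨ star (U : Matrix (Fin 2) (Fin 2) ℂ) * V = -1 ↔ _
  have key : ∀ W : Matrix (Fin 2) (Fin 2) ℂ, star (U : Matrix (Fin 2) (Fin 2) ℂ) * V = W ↔ (V : Matrix (Fin 2) (Fin 2) ℂ) = U * W := by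
    intro W
    constructor
    · rintro rfl; rw [← mul_assoc, SU2.mul_star, one_mul]
    · intro h; rw [h, ← mul_assoc, SU2.star_mul, one_mul]
  rw [key, key]
  simp

/-- The monomorphism `τ : S¹ → SU(2)`, `τ(ζ) = diag(ζ, ζ̄)`. -/
def tau : Circle →* SU2 where
  toFun z := ⟨!![(z : ℂ), 0; 0, star (z : ℂ)], by
    have h : (z : ℂ) * (starRingEnd ℂ) (z : ℂ) = 1 := by rw [Complex.mul_conj]; simp
    refine Matrix.mem_specialUnitaryGroup_iff.2 ⟨Matrix.mem_unitaryGroup_iff.2 ?_, ?_⟩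
    · ext i j
      fin_cases i <;> fin_cases j <;>
        simp [Matrix.mul_apply, Fin.sum_univ_two, Matrix.star_apply, h, mul_comm]
    · simpa [Matrix.det_fin_two_of] using h⟩
  map_one' := by
    refine Subtype.ext ?_
    ext i j
    fin_cases i <;> fin_cases j <;> simp
  map_mul' z w := by
    refine Subtype.ext ?_
    ext i j
    fin_cases i <;> fin_cases j <;> simp [mul_comm]

theorem coe_tau (z : Circle) : (tau z : Matrix (Fin 2) (Fin 2) ℂ) = !![(z : ℂ), 0; 0, star (z : ℂ)] := rfl

theorem mk_tau_half (w : Circle) : (QuotientGroup.mk (tau (Circle.exp (Complex.arg (w * w : Circle) / 2))) : PU2) =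
    QuotientGroup.mk (tau w) := by
  set v := Circle.exp (Complex.arg (w * w : Circle) / 2) with hv
  have h : v * v = w * w := by
    rw [hv, ← Circle.exp_add, add_halves, Circle.exp_arg]
  have h' : (w : ℂ) = v ∨ (w : ℂ) = -v := by
    have := congrArg (fun z : Circle => (z : ℂ)) h
    simp only [Circle.coe_mul] at this
    exact mul_self_eq_mul_self_iff.1 this.symm
  rw [PU2.mk_eq_iff, coe_tau, coe_tau]
  rcases h' with h' | h' <;> simp [h']

/-- The monomorphism `θ : S¹ → PU(2)`, `θ(e^{it}) = [τ(e^{it/2})]`. -/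
def theta : Circle →* PU2 where
  toFun z := QuotientGroup.mk (tau (Circle.exp (Complex.arg z / 2)))
  map_one' := by simp
  map_mul' z w := by
    have key : ∀ u : Circle, Circle.exp (Complex.arg u / 2) * Circle.exp (Complex.arg u / 2) = u := by
      intro u
      rw [← Circle.exp_add, add_halves, Circle.exp_arg]
    rw [← QuotientGroup.mk_mul, ← map_mul, ← mk_tau_half (Circle.exp (Complex.arg z / 2) * Circle.exp (Complex.arg w / 2)),
      mul_mul_mul_comm, key, key]

theorem theta_exp (t : ℝ) : theta (Circle.exp t) = QuotientGroup.mk (tau (Circle.exp (t / 2))) := by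
  rw [← mk_tau_half, ← Circle.exp_add, add_halves]
  rfl

/-- The morphism `χ = θ ∘ σ : H → PU(2)`. -/
def chi : stab →* PU2 := theta.comp sigma

theorem chi_rot (t : ℝ) : chi ⟨QuotientGroup.mk (rot t), rot_mem t⟩ =
    QuotientGroup.mk (tau (Circle.exp (t / 2))) := by
  rw [chi, MonoidHom.comp_apply, sigma_rot, theta_exp]

/-- The basis `a₁, a₂, a₃` of the Lie algebra `su(2)`. -/
def aBasis : Fin 3 → Matrix (Fin 2) (Fin 2) ℂ :=
  ![(1 / 2 : ℂ) • !![0, Complex.I; Complex.I, 0], (1 / 2 : ℂ) • !![0, -1; 1, 0],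
    (1 / 2 : ℂ) • !![Complex.I, 0; 0, -Complex.I]]

/-- The coordinates of an element of `su(2)` in the basis `a₁, a₂, a₃`, see `sum_coord`. -/
def coord (i : Fin 3) : Matrix (Fin 2) (Fin 2) ℂ →ₗ[ℝ] ℝ where
  toFun X := -2 * (Matrix.trace (aBasis i * X)).re
  map_add' X Y := by simp [mul_add]
  map_smul' c X := by simp; ring

theorem sum_coord {X : Matrix (Fin 2) (Fin 2) ℂ} (h : star X = -X) (h' : Matrix.trace X = 0) :
    ∑ i, coord i X • aBasis i = X := by
  have h00 := congrFun (congrFun h 0) 0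
  have h01 := congrFun (congrFun h 0) 1
  rw [Matrix.trace_fin_two] at h'
  simp only [Matrix.star_apply, Matrix.neg_apply] at h00 h01
  have e1 := congrArg Complex.re h00
  have e2 := congrArg Complex.re h01
  have e3 := congrArg Complex.im h01
  have e4 := congrArg Complex.re h'
  have e5 := congrArg Complex.im h'
  simp at e1 e2 e3 e4 e5
  ext i j
  apply Complex.ext <;> fin_cases i <;> fin_cases j <;>
    simp [Fin.sum_univ_three, coord, aBasis, Matrix.trace_fin_two, Matrix.mul_apply, Fin.sum_univ_two] <;> linarith

theorem star_aBasis (i : Fin 3) : star (aBasis i) = - aBasis i := by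
  ext k l
  fin_cases i <;> fin_cases k <;> fin_cases l <;> simp [aBasis, Matrix.star_apply]

theorem trace_aBasis (i : Fin 3) : Matrix.trace (aBasis i) = 0 := by
  fin_cases i <;> simp [aBasis, Matrix.trace_fin_two]

/-- The matrix of the adjoint action of `U ∈ SU(2)` on `su(2)` in the basis `a₁, a₂, a₃`. -/
def adMatrix (U : SU2) : Matrix (Fin 3) (Fin 3) ℝ :=
  Matrix.of fun i j => coord i (U * aBasis j * star (U : Matrix (Fin 2) (Fin 2) ℂ))

theorem adMatrix_mul (U V : SU2) : adMatrix (U * V) = adMatrix U * adMatrix V := by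
  ext i j
  have hV : ∑ k, coord k (V * aBasis j * star (V : Matrix (Fin 2) (Fin 2) ℂ)) • aBasis k =
      V * aBasis j * star (V : Matrix (Fin 2) (Fin 2) ℂ) := by
    refine sum_coord ?_ ?_
    · simp [star_aBasis, mul_assoc]
    · rw [Matrix.trace_mul_comm, ← mul_assoc, SU2.star_mul, one_mul, trace_aBasis]
  have h : ((U * V : SU2) : Matrix (Fin 2) (Fin 2) ℂ) * aBasis j * star ((U * V : SU2) : Matrix (Fin 2) (Fin 2) ℂ) =
      U * (V * aBasis j * star (V : Matrix (Fin 2) (Fin 2) ℂ)) * star (U : Matrix (Fin 2) (Fin 2) ℂ) := by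
    simp [mul_assoc]
  rw [adMatrix, Matrix.of_apply, h, ← hV, Matrix.mul_apply, Finset.mul_sum, Finset.sum_mul, map_sum]
  refine Finset.sum_congr rfl fun k _ => ?_
  rw [mul_smul_comm, smul_mul_assoc, map_smul, smul_eq_mul, mul_comm]
  rfl

theorem SU2.entries (U : SU2) : (U : Matrix (Fin 2) (Fin 2) ℂ) 1 1 = star ((U : Matrix (Fin 2) (Fin 2) ℂ) 0 0) ∧
    (U : Matrix (Fin 2) (Fin 2) ℂ) 1 0 = -star ((U : Matrix (Fin 2) (Fin 2) ℂ) 0 1) := by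
  have h : star (U : Matrix (Fin 2) (Fin 2) ℂ) = Matrix.adjugate (U : Matrix (Fin 2) (Fin 2) ℂ) := by
    have h1 : Matrix.det (U : Matrix (Fin 2) (Fin 2) ℂ) = 1 := (Matrix.mem_specialUnitaryGroup_iff.1 U.2).2
    have h2 := Matrix.mul_adjugate (U : Matrix (Fin 2) (Fin 2) ℂ)
    rw [h1, one_smul] at h2
    calc _ = star (U : Matrix (Fin 2) (Fin 2) ℂ) * (U * Matrix.adjugate (U : Matrix (Fin 2) (Fin 2) ℂ)) := by rw [h2, mul_one]
      _ = _ := by rw [← mul_assoc, SU2.star_mul, one_mul]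
  have h00 := congrFun (congrFun h 0) 0
  have h10 := congrFun (congrFun h 1) 0
  rw [Matrix.adjugate_fin_two] at h00 h10
  simp [Matrix.star_apply] at h00 h10
  constructor
  · rw [← h00]; rfl
  · rw [← neg_neg (U.1 1 0), ← h10]; rfl

theorem adMatrix_mem (U : SU2) : adMatrix U ∈ Matrix.specialOrthogonalGroup (Fin 3) ℝ := by
  obtain ⟨h1, h2⟩ := SU2.entries U
  have hdet : Matrix.det (U : Matrix (Fin 2) (Fin 2) ℂ) = 1 := (Matrix.mem_specialUnitaryGroup_iff.1 U.2).2
  rw [Matrix.det_fin_two, h1, h2] at hdet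
  set a := (U : Matrix (Fin 2) (Fin 2) ℂ) 0 0
  set b := (U : Matrix (Fin 2) (Fin 2) ℂ) 0 1
  have hn : a.re ^ 2 + a.im ^ 2 + b.re ^ 2 + b.im ^ 2 = 1 := by
    have := congrArg Complex.re hdet
    simp at this
    linarith
  have hM : adMatrix U =
      !![a.re * a.re - a.im * a.im - b.re * b.re + b.im * b.im,
          -2 * a.re * a.im - 2 * b.re * b.im, -2 * a.re * b.re + 2 * a.im * b.im;
        2 * a.re * a.im - 2 * b.re * b.im,
          a.re * a.re - a.im * a.im + b.re * b.re - b.im * b.im,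
          -2 * a.re * b.im - 2 * a.im * b.re;
        2 * a.re * b.re + 2 * a.im * b.im, 2 * a.re * b.im - 2 * a.im * b.re,
          a.re * a.re + a.im * a.im - b.re * b.re - b.im * b.im] := by
    ext i j
    fin_cases i <;> fin_cases j <;>
      simp [adMatrix, coord, aBasis, Matrix.trace_fin_two, Matrix.mul_apply, Fin.sum_univ_two,
        Matrix.star_apply, h1, h2] <;> ring
  rw [hM, Matrix.mem_specialOrthogonalGroup_iff]
  generalize a.re = p at *
  generalize a.im = q at *
  generalize b.re = r at *
  generalize b.im = s at *
  constructor
  · rw [Matrix.mem_orthogonalGroup_iff]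
    ext i j
    fin_cases i <;> fin_cases j <;>
      simp [Matrix.mul_apply, Fin.sum_univ_three] <;>
      first
        | linear_combination (p ^ 2 + q ^ 2 + r ^ 2 + s ^ 2 + 1) * hn
        | ring
  · rw [Matrix.det_fin_three]
    simp
    linear_combination ((p ^ 2 + q ^ 2 + r ^ 2 + s ^ 2) ^ 2 +
      (p ^ 2 + q ^ 2 + r ^ 2 + s ^ 2) + 1) * hn

/-- The group `SO(3)`. -/
abbrev SO3 : Type := Matrix.specialOrthogonalGroup (Fin 3) ℝ

/-- The standard isomorphism `PU(2) → SO(su(2)) = SO(3)` given by the adjoint action, in the basis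
`a₁, a₂, a₃` of `su(2)`. -/
def Ad : PU2 →* SO3 :=
  QuotientGroup.lift signs
    { toFun := fun U => ⟨adMatrix U, adMatrix_mem U⟩
      map_one' := Subtype.ext (by
        ext i j
        fin_cases i <;> fin_cases j <;>
          simp [adMatrix, coord, aBasis, Matrix.trace_fin_two, Matrix.mul_apply,
            Fin.sum_univ_two] <;> norm_num)
      map_mul' := fun U V => Subtype.ext (adMatrix_mul U V) } (by
    intro U hU
    refine Subtype.ext ?_
    have h1 : adMatrix U = adMatrix 1 := by
      ext i j
      rcases hU with h | h <;> simp [adMatrix, h]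
    refine h1.trans ?_
    ext i j
    fin_cases i <;> fin_cases j <;>
      simp [adMatrix, coord, aBasis, Matrix.trace_fin_two, Matrix.mul_apply,
        Fin.sum_univ_two] <;> norm_num)

theorem Ad_mk (U : SU2) : (Ad (QuotientGroup.mk U) : Matrix (Fin 3) (Fin 3) ℝ) = adMatrix U := rfl

/-- The differential `su(2) → so(3)` of `Ad`: it maps `X` to the matrix of `[X, ·]` in the basis
`a₁, a₂, a₃`. -/
def adStar : Matrix (Fin 2) (Fin 2) ℂ →L[ℝ] Matrix (Fin 3) (Fin 3) ℝ :=
  LinearMap.toContinuousLinearMap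
    { toFun := fun X => Matrix.of fun i j => coord i (X * aBasis j - aBasis j * X)
      map_add' := fun X Y => by
        ext i j
        simp only [Matrix.of_apply, Matrix.add_apply, ← map_add]
        congr 1
        noncomm_ring
      map_smul' := fun c X => by
        ext i j
        simp only [Matrix.of_apply, Matrix.smul_apply, RingHom.id_apply, ← map_smul]
        congr 1
        simp [smul_sub] }

/-! ### The homogeneous bundle `P_χ` and its invariant connections -/

/-- The relation `(g h, k) ∼ (g, χ(h) k)`, for `h ∈ H`, on `PSL(2, ℝ) × PU(2)`. -/
def assocSetoid : Setoid (PSL(2, ℝ) × PU2) where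
  r x y := ∃ h : stab, y.1 = x.1 * h ∧ y.2 = (chi h)⁻¹ * x.2
  iseqv :=
    { refl := fun x => ⟨1, by simp⟩
      symm := by
        rintro ⟨g, k⟩ ⟨g', k'⟩ ⟨h, rfl, rfl⟩
        exact ⟨h⁻¹, by simp⟩
      trans := by
        rintro ⟨g, k⟩ ⟨g', k'⟩ ⟨g'', k''⟩ ⟨h, rfl, rfl⟩ ⟨h', rfl, rfl⟩
        exact ⟨h * h', by simp [mul_assoc]⟩ }

/-- The total space of the associated principal bundle `P_χ = PSL(2, ℝ) ×_χ PU(2)`. -/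
def P : Type := Quotient assocSetoid

namespace P

/-- The class `[g, k]`. -/
def mk (g : PSL(2, ℝ)) (k : PU2) : P := Quotient.mk assocSetoid (g, k)

theorem mk_eq_iff (g g' : PSL(2, ℝ)) (k k' : PU2) :
    mk g k = mk g' k' ↔ ∃ h : stab, g' = g * h ∧ k' = (chi h)⁻¹ * k :=
  Quotient.eq (r := assocSetoid)

/-- The bundle projection `[g, k] ↦ g • i`. -/
def proj : P → UpperHalfPlane :=
  Quotient.lift (fun x => moebius x.1 UpperHalfPlane.I) (by
    rintro ⟨g, k⟩ ⟨g', k'⟩ ⟨h, h1, -⟩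
    have h2 : moebius h UpperHalfPlane.I = UpperHalfPlane.I := h.2
    dsimp only at h1 ⊢
    rw [h1, map_mul, Equiv.Perm.mul_apply, h2])

/-- The right action of `PU(2)`: `[g, k] k' = [g, k k']`. -/
def act (y : P) (k' : PU2) : P :=
  Quotient.lift (fun x => mk x.1 (x.2 * k')) (by
    rintro ⟨g, k⟩ ⟨g', k₁⟩ ⟨h, h1, h2⟩
    exact (mk_eq_iff _ _ _ _).2 ⟨h, h1, by dsimp only at h2 ⊢; rw [h2, mul_assoc]⟩) y

/-- The smooth structure of the Lie group `SL(2, ℝ) × SU(2)`, a submanifold of a product of matrix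
spaces. -/
instance : DiffeologicalSpace (SL(2, ℝ) × SU2) :=
  embeddedDiffeology (fun x =>
    ((x.1 : Matrix (Fin 2) (Fin 2) ℝ), (x.2 : Matrix (Fin 2) (Fin 2) ℂ)))

/-- The projection `SL(2, ℝ) × SU(2) → PSL(2, ℝ) × PU(2) → P_χ`. -/
def quot (x : SL(2, ℝ) × SU2) : P := mk (QuotientGroup.mk x.1) (QuotientGroup.mk x.2)

theorem quot_surjective : Function.Surjective quot := by
  rintro ⟨g, k⟩
  induction g using QuotientGroup.induction_on with
  | H A =>
  induction k using QuotientGroup.induction_on with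
  | H U => exact ⟨(A, U), rfl⟩

/-- The smooth structure of `P_χ`, as a quotient of the Lie group `SL(2, ℝ) × SU(2)`. -/
instance : DiffeologicalSpace P := quotientDiffeology quot quot_surjective

end P

/-- For `X = u₁ b₁ + u₂ b₂ + u₃ b₃` in `sl(2, ℝ)`, where `h = ℝ b₃` and `s = ⟨b₁, b₂⟩`, the element
`χ_*(u₃ b₃) + s μ₀(u₁ b₁ + u₂ b₂) = u₃ a₃ + s (u₁ a₂ - u₂ a₁)` of `su(2)`. -/
def lam (s : ℝ) : Matrix (Fin 2) (Fin 2) ℝ →L[ℝ] Matrix (Fin 2) (Fin 2) ℂ :=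
  LinearMap.toContinuousLinearMap
    { toFun := fun X => (X 0 1 - X 1 0) • aBasis 2 +
        s • ((X 0 1 + X 1 0) • aBasis 1 - (X 0 0 - X 1 1) • aBasis 0)
      map_add' := fun X Y => by
        simp only [Matrix.add_apply]
        module
      map_smul' := fun c X => by
        simp only [Matrix.smul_apply, smul_eq_mul, RingHom.id_apply]
        module }

theorem lam_apply (s : ℝ) (X : Matrix (Fin 2) (Fin 2) ℝ) :
    lam s X = (X 0 1 - X 1 0) • aBasis 2 +
        s • ((X 0 1 + X 1 0) • aBasis 1 - (X 0 0 - X 1 1) • aBasis 0) := rfl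

/-- The basis `b₁, b₂, b₃` of `sl(2, ℝ)`. -/
def bBasis : Fin 3 → Matrix (Fin 2) (Fin 2) ℝ :=
  ![(1 / 2 : ℝ) • !![0, 1; 1, 0], (1 / 2 : ℝ) • !![1, 0; 0, -1], (1 / 2 : ℝ) • !![0, 1; -1, 0]]

theorem lam_bBasis (s u₁ u₂ u₃ : ℝ) : lam s (u₁ • bBasis 0 + u₂ • bBasis 1 + u₃ • bBasis 2) =
    u₃ • aBasis 2 + s • (u₁ • aBasis 1 - u₂ • aBasis 0) := by
  rw [lam_apply]
  congr 2
  · simp [bBasis]; ring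
  · congr 2 <;> simp [bBasis] <;> ring

theorem contDiff_ringInverse {V : Type*} [NormedRing V] [NormedAlgebra ℝ V] [CompleteSpace V]
    {n : ℕ} {p : E n → V} (hp : ContDiff ℝ ∞ p) (h : ∀ x, IsUnit (p x)) :
    ContDiff ℝ ∞ (fun x => Ring.inverse (p x)) := by
  refine contDiff_iff_contDiffAt.2 fun x => ?_
  obtain ⟨u, hu⟩ := h x
  have h1 : ContDiffAt ℝ ∞ (Ring.inverse : V → V) (p x) := by
    rw [← hu]; exact contDiffAt_ringInverse ℝ u
  exact h1.comp x hp.contDiffAt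

theorem contDiff_inv_real {n m : ℕ} {p : E n → Matrix (Fin m) (Fin m) ℝ}
    (hp : ContDiff ℝ ∞ p) (h : ∀ x, IsUnit (p x)) : ContDiff ℝ ∞ (fun x => (p x)⁻¹) := by
  simp only [Matrix.nonsing_inv_eq_ringInverse]
  exact contDiff_ringInverse hp h

theorem contDiff_inv_complex {n m : ℕ} {p : E n → Matrix (Fin m) (Fin m) ℂ}
    (hp : ContDiff ℝ ∞ p) (h : ∀ x, IsUnit (p x)) : ContDiff ℝ ∞ (fun x => (p x)⁻¹) := by
  simp only [Matrix.nonsing_inv_eq_ringInverse]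
  exact contDiff_ringInverse hp h

theorem SU2.isUnit (U : SU2) : IsUnit (U : Matrix (Fin 2) (Fin 2) ℂ) :=
  (Matrix.isUnit_iff_isUnit_det _).2 (by
    rw [(Matrix.mem_specialUnitaryGroup_iff.1 U.2).2]; exact isUnit_one)

theorem SL2.isUnit (A : SL(2, ℝ)) : IsUnit (A : Matrix (Fin 2) (Fin 2) ℝ) :=
  (Matrix.isUnit_iff_isUnit_det _).2 (by rw [A.det_coe]; exact isUnit_one)

theorem isPlot_up_iff {n : ℕ} {p : E n → SL(2, ℝ) × SU2} : IsPlot p ↔ ContDiff ℝ ∞ (fun y =>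
    (((p y).1 : Matrix (Fin 2) (Fin 2) ℝ), ((p y).2 : Matrix (Fin 2) (Fin 2) ℂ))) := Iff.rfl

theorem contDiff_fst_of_isPlot {n : ℕ} {p : E n → SL(2, ℝ) × SU2} (hp : IsPlot p) :
    ContDiff ℝ ∞ (fun y => ((p y).1 : Matrix (Fin 2) (Fin 2) ℝ)) := (isPlot_up_iff.1 hp).fst

theorem contDiff_snd_of_isPlot {n : ℕ} {p : E n → SL(2, ℝ) × SU2} (hp : IsPlot p) :
    ContDiff ℝ ∞ (fun y => ((p y).2 : Matrix (Fin 2) (Fin 2) ℂ)) := (isPlot_up_iff.1 hp).snd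

/-- The 1-form `k⁻¹ λ(g⁻¹ dg) k + k⁻¹ dk` on `SL(2, ℝ) × SU(2)`, where `λ` is `lam s`. -/
def upForm (s : ℝ) : OneForm (SL(2, ℝ) × SU2) (Matrix (Fin 2) (Fin 2) ℂ) where
  toFun p _ x :=
    let A := fun y => ((p y).1 : Matrix (Fin 2) (Fin 2) ℝ)
    let U := fun y => ((p y).2 : Matrix (Fin 2) (Fin 2) ℂ)
    (ContinuousLinearMap.mulLeftRight ℝ _ (U x)⁻¹ (U x)).comp
        ((lam s).comp ((ContinuousLinearMap.mul ℝ _ (A x)⁻¹).comp (fderiv ℝ A x))) +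
      (ContinuousLinearMap.mul ℝ _ (U x)⁻¹).comp (fderiv ℝ U x)
  smooth p hp := by
    have hA : ContDiff ℝ ∞ (fun y => ((p y).1 : Matrix (Fin 2) (Fin 2) ℝ)) := contDiff_fst_of_isPlot hp
    have hU : ContDiff ℝ ∞ (fun y => ((p y).2 : Matrix (Fin 2) (Fin 2) ℂ)) := contDiff_snd_of_isPlot hp
    have hA' := contDiff_inv_real hA (fun x => SL2.isUnit _)
    have hU' := contDiff_inv_complex hU (fun x => SU2.isUnit _)
    have dA := hA.fderiv_right (m := ∞) (by simp)
    have dU := hU.fderiv_right (m := ∞) (by simp)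
    refine ContDiff.add (ContDiff.clm_comp ?_ (contDiff_const.clm_comp (ContDiff.clm_comp ?_ dA)))
      (ContDiff.clm_comp ?_ dU)
    · exact ((ContinuousLinearMap.contDiff _).comp hU').clm_apply hU
    · exact (ContinuousLinearMap.contDiff _).comp hA'
    · exact (ContinuousLinearMap.contDiff _).comp hU'
  reparam p hp f hf x := by
    have hA : ContDiff ℝ ∞ (fun y => ((p y).1 : Matrix (Fin 2) (Fin 2) ℝ)) := contDiff_fst_of_isPlot hp
    have hU : ContDiff ℝ ∞ (fun y => ((p y).2 : Matrix (Fin 2) (Fin 2) ℂ)) := contDiff_snd_of_isPlot hp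
    have cA := fderiv_comp (g := fun y => ((p y).1 : Matrix (Fin 2) (Fin 2) ℝ)) x
      (hA.differentiable (by simp) (f x)) (hf.differentiable (by simp) x)
    have cU := fderiv_comp (g := fun y => ((p y).2 : Matrix (Fin 2) (Fin 2) ℂ)) x
      (hU.differentiable (by simp) (f x)) (hf.differentiable (by simp) x)
    simp only [Function.comp_def] at cA cU ⊢
    rw [cA, cU]
    ext v
    rfl

theorem upForm_apply (s : ℝ) {n : ℕ} (p : E n → SL(2, ℝ) × SU2) (hp : IsPlot p) (x v : E n) :
    (upForm s).toFun p hp x v =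
      ((p x).2 : Matrix (Fin 2) (Fin 2) ℂ)⁻¹ *
        lam s (((p x).1 : Matrix (Fin 2) (Fin 2) ℝ)⁻¹ *
          fderiv ℝ (fun y => ((p y).1 : Matrix (Fin 2) (Fin 2) ℝ)) x v) *
        ((p x).2 : Matrix (Fin 2) (Fin 2) ℂ) +
      ((p x).2 : Matrix (Fin 2) (Fin 2) ℂ)⁻¹ *
        fderiv ℝ (fun y => ((p y).2 : Matrix (Fin 2) (Fin 2) ℂ)) x v := rfl

/-- The diagonal matrix `diag(a + ib, a - ib)`, for `R` with first row `(a, b)`. -/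
def diagOf (R : Matrix (Fin 2) (Fin 2) ℝ) : Matrix (Fin 2) (Fin 2) ℂ :=
  !![(R 0 0 : ℂ) + R 0 1 * Complex.I, 0; 0, (R 0 0 : ℂ) - R 0 1 * Complex.I]

theorem chi_mk (R : SL(2, ℝ)) (h : (QuotientGroup.mk R : PSL(2, ℝ)) ∈ stab) :
    ∃ D : SU2, (D : Matrix (Fin 2) (Fin 2) ℂ) = diagOf R ∧
      chi ⟨QuotientGroup.mk R, h⟩ = QuotientGroup.mk D := by
  have hn : ‖(R 0 0 : ℂ) + R 0 1 * Complex.I‖ = 1 := by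
    have h1 := stab_sq h
    have h2 : ‖(R 0 0 : ℂ) + R 0 1 * Complex.I‖ ^ 2 = 1 := by
      rw [← Complex.normSq_eq_norm_sq, Complex.normSq_add_mul_I, h1]
    nlinarith [norm_nonneg ((R 0 0 : ℂ) + R 0 1 * Complex.I)]
  let w : Circle := ⟨(R 0 0 : ℂ) + R 0 1 * Complex.I, mem_sphere_zero_iff_norm.2 hn⟩
  refine ⟨tau w, ?_, ?_⟩
  · rw [coe_tau, diagOf]
    have : (w : ℂ) = (R 0 0 : ℂ) + R 0 1 * Complex.I := rfl
    rw [this]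
    simp [sub_eq_add_neg]
  · have hs : sigma ⟨QuotientGroup.mk R, h⟩ = w * w := by
      refine Circle.ext ?_
      rw [coe_sigma, Circle.coe_mul]
      exact (sigmaFun_mk R).trans (sq _)
    rw [chi, MonoidHom.comp_apply, hs]
    exact mk_tau_half w

/-- Two elements of `SL(2, ℝ) × SU(2)` have the same class in `P_χ` iff they differ by an element
of `H` and a sign. -/
theorem quot_eq {x y : SL(2, ℝ) × SU2} (h : P.quot x = P.quot y) :
    ∃ R : Matrix (Fin 2) (Fin 2) ℝ, R = (x.1 : Matrix (Fin 2) (Fin 2) ℝ)⁻¹ * y.1 ∧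
      R 1 0 = - R 0 1 ∧ R 1 1 = R 0 0 ∧ R 0 0 ^ 2 + R 0 1 ^ 2 = 1 ∧
      ∃ ε : ℂ, (ε = 1 ∨ ε = -1) ∧ diagOf R * (y.2 : Matrix (Fin 2) (Fin 2) ℂ) = ε • (x.2 : Matrix (Fin 2) (Fin 2) ℂ) := by
  obtain ⟨⟨g, hg⟩, h1, h2⟩ := (P.mk_eq_iff _ _ _ _).1 h
  have hg' : g = QuotientGroup.mk (x.1⁻¹ * y.1) := by
    rw [QuotientGroup.mk_mul, QuotientGroup.mk_inv, h1, inv_mul_cancel_left]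
  subst hg'
  have hR : (x.1 : Matrix (Fin 2) (Fin 2) ℝ)⁻¹ * y.1 = ((x.1⁻¹ * y.1 : SL(2, ℝ)) : Matrix (Fin 2) (Fin 2) ℝ) := by
    rw [Matrix.SpecialLinearGroup.coe_mul, Matrix.SpecialLinearGroup.coe_inv, Matrix.inv_def, x.1.det_coe]
    simp
  obtain ⟨D, hD, hD'⟩ := chi_mk _ hg
  obtain ⟨e1, e2⟩ := (mk_mem_stab_iff _).1 hg
  refine ⟨_, rfl, ?_⟩
  rw [hR]
  refine ⟨e1, e2, stab_sq hg, ?_⟩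
  rw [hD', ← QuotientGroup.mk_inv, ← QuotientGroup.mk_mul, eq_comm, PU2.mk_eq_iff] at h2
  rw [← hD]
  have key : (D : Matrix (Fin 2) (Fin 2) ℂ) * ((D⁻¹ * x.2 : SU2) : Matrix (Fin 2) (Fin 2) ℂ) = x.2 := by
    change (D : Matrix (Fin 2) (Fin 2) ℂ) * (star (D : Matrix (Fin 2) (Fin 2) ℂ) * (x.2 : Matrix (Fin 2) (Fin 2) ℂ)) = _
    rw [← mul_assoc, SU2.mul_star, one_mul]
  rcases h2 with h2 | h2
  · exact ⟨1, Or.inl rfl, by rw [one_smul, ← key, h2]⟩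
  · refine ⟨-1, Or.inr rfl, ?_⟩
    rw [neg_smul, one_smul, ← key, h2, mul_neg]

/-- The real linear map `diagOf`. -/
def diagOfL : Matrix (Fin 2) (Fin 2) ℝ →L[ℝ] Matrix (Fin 2) (Fin 2) ℂ :=
  LinearMap.toContinuousLinearMap
    { toFun := diagOf
      map_add' := fun X Y => by
        ext i j
        fin_cases i <;> fin_cases j <;> simp [diagOf] <;> ring
      map_smul' := fun c X => by
        ext i j
        fin_cases i <;> fin_cases j <;> simp [diagOf] <;> ring }

theorem diagOfL_apply (R : Matrix (Fin 2) (Fin 2) ℝ) : diagOfL R = diagOf R := rfl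

theorem lam_conj (s a b c d : ℝ) (h : a ^ 2 + b ^ 2 = 1) (h' : a * c + b * d = 0)
    (Y : Matrix (Fin 2) (Fin 2) ℝ) :
    diagOf !![a, b; -b, a] * lam s (!![a, -b; b, a] * (Y * !![a, b; -b, a] + !![c, d; -d, c])) -
      diagOf !![c, d; -d, c] = lam s Y * diagOf !![a, b; -b, a] := by
  have hc : c = -b * (a * d - b * c) := by linear_combination (-c) * h + a * h'
  have hd : d = a * (a * d - b * c) := by linear_combination (-d) * h + b * h'
  generalize a * d - b * c = e at hc hd
  subst hc hd
  clear h'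
  rw [Matrix.eta_fin_two Y]
  generalize Y 0 0 = p, Y 0 1 = q, Y 1 0 = r, Y 1 1 = u
  have e1 : (!![a, -b; b, a] : Matrix (Fin 2) (Fin 2) ℝ) * (!![p, q; r, u] * !![a, b; -b, a] +
      !![-b * e, a * e; -(a * e), -b * e]) =
      !![a * (p * a - q * b) - b * (r * a - u * b), a * (p * b + q * a) - b * (r * b + u * a) + e;
        b * (p * a - q * b) + a * (r * a - u * b) - e, b * (p * b + q * a) + a * (r * b + u * a)] := by
    ext i j
    fin_cases i <;> fin_cases j <;> simp [Matrix.mul_apply, Fin.sum_univ_two] <;>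
      first
        | ring1
        | linear_combination e * h
        | linear_combination (-e) * h
  rw [e1]
  ext i j
  apply Complex.ext <;> fin_cases i <;> fin_cases j <;>
    simp [lam_apply, diagOf, aBasis, Matrix.mul_apply, Fin.sum_univ_two]
  all_goals
    first
      | linear_combination (-(q - r) * b / 2) * h
      | linear_combination ((q - r) * a / 2) * h
      | linear_combination (-(q - r) * a / 2) * h
      | linear_combination (-(s / 2) * ((q + r) * a + (p - u) * b)) * h
      | linear_combination ((s / 2) * ((q + r) * a + (p - u) * b)) * h
      | linear_combination (-(s / 2) * ((p - u) * a - (q + r) * b)) * h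

theorem upForm_eq (s : ℝ) {n : ℕ} (p p' : E n → SL(2, ℝ) × SU2) (hp : IsPlot p) (hp' : IsPlot p')
    (x : E n) (h : ∀ᶠ y in 𝓝 x, P.quot (p y) = P.quot (p' y)) :
    (upForm s).toFun p hp x = (upForm s).toFun p' hp' x := by
  ext1 v
  rw [upForm_apply, upForm_apply]
  have iA : ∀ y, IsUnit ((p y).1 : Matrix (Fin 2) (Fin 2) ℝ) := fun y => SL2.isUnit _
  have iU : ∀ y, IsUnit ((p y).2 : Matrix (Fin 2) (Fin 2) ℂ) := fun y => SU2.isUnit _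
  have iU' : IsUnit ((p' x).2 : Matrix (Fin 2) (Fin 2) ℂ) := SU2.isUnit _
  have h := h.mono fun y hy => quot_eq hy
  have hA := contDiff_fst_of_isPlot hp
  have hA' := contDiff_fst_of_isPlot hp'
  have hU := contDiff_snd_of_isPlot hp
  have hU' := contDiff_snd_of_isPlot hp'
  obtain ⟨A, eA⟩ : ∃ A, A = (fun y => ((p y).1 : Matrix (Fin 2) (Fin 2) ℝ)) := ⟨_, rfl⟩
  obtain ⟨A', eA'⟩ : ∃ A, A = (fun y => ((p' y).1 : Matrix (Fin 2) (Fin 2) ℝ)) := ⟨_, rfl⟩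
  obtain ⟨U, eU⟩ : ∃ A, A = (fun y => ((p y).2 : Matrix (Fin 2) (Fin 2) ℂ)) := ⟨_, rfl⟩
  obtain ⟨U', eU'⟩ : ∃ A, A = (fun y => ((p' y).2 : Matrix (Fin 2) (Fin 2) ℂ)) := ⟨_, rfl⟩
  have fA := fun y => congrFun eA y
  have fA' := fun y => congrFun eA' y
  have fU := fun y => congrFun eU y
  have fU' := fun y => congrFun eU' y
  simp only [← eA, ← eA', ← eU, ← eU'] at hA hA' hU hU' ⊢
  simp only [← fA, ← fA', ← fU, ← fU'] at iA iU iU' h ⊢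
  clear fA fA' fU fU' eA eA' eU eU'
  have iA' : ∀ y, IsUnit (A y).det := fun y => (Matrix.isUnit_iff_isUnit_det _).1 (iA y)
  have jU : ∀ y, IsUnit (U y).det := fun y => (Matrix.isUnit_iff_isUnit_det _).1 (iU y)
  have jU' : IsUnit (U' x).det := (Matrix.isUnit_iff_isUnit_det _).1 iU'
  -- the transition function to `H`, and its derivative
  obtain ⟨R, hR⟩ : ∃ R, R = (fun y => (A y)⁻¹ * A' y) := ⟨_, rfl⟩
  have hRy : ∀ y, (A y)⁻¹ * A' y = R y := fun y => by rw [hR]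
  have cR : ContDiff ℝ ∞ R := by
    rw [hR]; exact (contDiff_inv_real hA iA).mul hA'
  simp only [hRy] at h
  have dR := (cR.differentiable (by simp) x).hasFDerivAt
  have dA := (hA.differentiable (by simp) x).hasFDerivAt
  have dA' := (hA'.differentiable (by simp) x).hasFDerivAt
  have dU := (hU.differentiable (by simp) x).hasFDerivAt
  have dU' := (hU'.differentiable (by simp) x).hasFDerivAt
  have hAR : ∀ y, A' y = A y * R y := fun y => by
    rw [← hRy, ← mul_assoc, Matrix.mul_nonsing_inv _ (iA' y), one_mul]
  have dAv : fderiv ℝ A' x v = A x * fderiv ℝ R x v + fderiv ℝ A x v * R x := by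
    have h1 := (dA.mul' dR).congr_of_eventuallyEq (Filter.Eventually.of_forall hAR)
    have h2 : fderiv ℝ A' x = A x • fderiv ℝ R x + MulOpposite.op (R x) • fderiv ℝ A x := h1.fderiv
    rw [h2]
    rfl
  have ent : ∀ i j, HasFDerivAt (fun y => R y i j)
      ((LinearMap.toContinuousLinearMap (Matrix.entryLinearMap ℝ ℝ i j)).comp (fderiv ℝ R x)) x := fun i j =>
    (LinearMap.toContinuousLinearMap (Matrix.entryLinearMap ℝ ℝ i j)).hasFDerivAt.comp x dR
  have r1 : fderiv ℝ R x v 1 0 = - fderiv ℝ R x v 0 1 := by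
    have h1 : HasFDerivAt (fun y => R y 1 0) _ x :=
      (ent 0 1).fun_neg.congr_of_eventuallyEq (h.mono fun y hy => by
        obtain ⟨R', e0, e1, -⟩ := hy
        rw [e0] at e1; exact e1)
    exact congrArg (fun L => L v) ((ent 1 0).unique h1)
  have r2 : fderiv ℝ R x v 1 1 = fderiv ℝ R x v 0 0 := by
    have h1 : HasFDerivAt (fun y => R y 1 1) _ x :=
      (ent 0 0).congr_of_eventuallyEq (h.mono fun y hy => by
        obtain ⟨R', e0, -, e1, -⟩ := hy
        rw [e0] at e1; exact e1)
    exact congrArg (fun L => L v) ((ent 1 1).unique h1)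
  have r3 : R x 0 0 * fderiv ℝ R x v 0 0 + R x 0 1 * fderiv ℝ R x v 0 1 = 0 := by
    have h1 : HasFDerivAt (fun _ => (1 : ℝ)) _ x :=
      (((ent 0 0).mul (ent 0 0)).add ((ent 0 1).mul (ent 0 1))).congr_of_eventuallyEq
        (h.mono fun y hy => by
          obtain ⟨R', e0, -, -, e1, -⟩ := hy
          rw [e0] at e1
          change 1 = R y 0 0 * R y 0 0 + R y 0 1 * R y 0 1
          linarith)
    have h2 := congrArg (fun L => L v) ((hasFDerivAt_const (1 : ℝ) x).unique h1)
    have h3 : (0 : ℝ) = (R x 0 0 * fderiv ℝ R x v 0 0 + R x 0 0 * fderiv ℝ R x v 0 0) +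
        (R x 0 1 * fderiv ℝ R x v 0 1 + R x 0 1 * fderiv ℝ R x v 0 1) := h2
    linarith
  -- the locally constant sign
  obtain ⟨S, hS⟩ : ∃ S, S = (fun y => diagOfL (R y) * U' y * (U y)⁻¹) := ⟨_, rfl⟩
  have cS : ContDiff ℝ ∞ S := by
    rw [hS]
    exact ((diagOfL.contDiff.comp cR).mul hU').mul (contDiff_inv_complex hU iU)
  have dS := (cS.differentiable (by simp) x).hasFDerivAt
  have S1 : ∀ᶠ y in 𝓝 x, S y * S y = 1 := h.mono fun y hy => by
    obtain ⟨R', e0, -, -, -, ε, hε, e1⟩ := hy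
    rw [e0, ← diagOfL_apply] at e1
    rw [hS]
    dsimp only
    rw [e1, smul_mul_assoc, Matrix.mul_nonsing_inv _ (jU y)]
    rcases hε with rfl | rfl <;> simp
  obtain ⟨R', e0, e1, e2, e3, ε, hε, e4⟩ := h.self_of_nhds
  subst e0
  have hεε : ε * ε = 1 := by rcases hε with rfl | rfl <;> simp
  have Sx : S x = ε • (1 : Matrix (Fin 2) (Fin 2) ℂ) := by
    rw [hS]
    dsimp only
    rw [diagOfL_apply, e4, smul_mul_assoc, Matrix.mul_nonsing_inv _ (jU x)]
  have dSv : fderiv ℝ S x v = 0 := by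
    have h1 : HasFDerivAt (fun _ => (1 : Matrix (Fin 2) (Fin 2) ℂ)) _ x :=
      (dS.mul' dS).congr_of_eventuallyEq (S1.mono fun y hy => hy.symm)
    have h2 := congrArg (fun L => L v) ((hasFDerivAt_const _ x).unique h1)
    have h3 : (0 : Matrix (Fin 2) (Fin 2) ℂ) = S x * fderiv ℝ S x v + fderiv ℝ S x v * S x := h2
    rw [Sx, smul_mul_assoc, mul_smul_comm, one_mul, mul_one, ← two_smul ℂ, smul_smul] at h3
    have hne : (2 * ε : ℂ) ≠ 0 := by rcases hε with rfl | rfl <;> simp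
    exact (smul_eq_zero.1 h3.symm).resolve_left hne
  have dDv : diagOfL (R x) * fderiv ℝ U' x v + diagOfL (fderiv ℝ R x v) * U' x = ε • fderiv ℝ U x v := by
    have hD : HasFDerivAt (fun y => diagOfL (R y)) (diagOfL.comp (fderiv ℝ R x)) x :=
      diagOfL.hasFDerivAt.comp x dR
    have h1 := hD.mul' dU'
    have h2 : HasFDerivAt ((fun y => diagOfL (R y)) * U') _ x :=
      (dS.mul' dU).congr_of_eventuallyEq (Filter.Eventually.of_forall fun y => by
        rw [hS]
        change diagOfL (R y) * U' y = diagOfL (R y) * U' y * (U y)⁻¹ * U y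
        rw [mul_assoc _ _ (U y), Matrix.nonsing_inv_mul _ (jU y), mul_one])
    have h3 := congrArg (fun L => L v) (h1.unique h2)
    have h4 : diagOfL (R x) * fderiv ℝ U' x v + diagOfL (fderiv ℝ R x v) * U' x =
        S x * fderiv ℝ U x v + fderiv ℝ S x v * U x := h3
    rw [h4, Sx, dSv, smul_mul_assoc, one_mul, zero_mul, add_zero]
  -- the computation at `x`
  have eR : R x = !![R x 0 0, R x 0 1; -R x 0 1, R x 0 0] := by
    conv_lhs => rw [Matrix.eta_fin_two (R x), e1, e2]
  have edR : fderiv ℝ R x v = !![fderiv ℝ R x v 0 0, fderiv ℝ R x v 0 1;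
      -fderiv ℝ R x v 0 1, fderiv ℝ R x v 0 0] := by
    conv_lhs => rw [Matrix.eta_fin_two (fderiv ℝ R x v), r1, r2]
  have hinv : (A' x)⁻¹ = !![R x 0 0, -R x 0 1; R x 0 1, R x 0 0] * (A x)⁻¹ := by
    refine Matrix.inv_eq_left_inv ?_
    rw [hAR, mul_assoc, ← mul_assoc (A x)⁻¹, Matrix.nonsing_inv_mul _ (iA' x), one_mul]
    nth_rewrite 5 [eR]
    ext i j
    fin_cases i <;> fin_cases j <;> simp [Matrix.mul_apply, Fin.sum_univ_two] <;>
      first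
        | ring1
        | linear_combination e3
  have key := lam_conj s _ _ _ _ e3 r3 ((A x)⁻¹ * fderiv ℝ A x v)
  rw [← eR, ← edR] at key
  have hMC : (A' x)⁻¹ * fderiv ℝ A' x v = !![R x 0 0, -R x 0 1; R x 0 1, R x 0 0] *
      ((A x)⁻¹ * fderiv ℝ A x v * R x + fderiv ℝ R x v) := by
    rw [hinv, dAv, mul_assoc, mul_add, ← mul_assoc (A x)⁻¹ (A x), Matrix.nonsing_inv_mul _ (iA' x),
      one_mul, ← mul_assoc, add_comm]
  rw [hMC]
  set Λ := lam s (!![R x 0 0, -R x 0 1; R x 0 1, R x 0 0] *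
      ((A x)⁻¹ * fderiv ℝ A x v * R x + fderiv ℝ R x v))
  set Λ₀ := lam s ((A x)⁻¹ * fderiv ℝ A x v)
  have hUinv : (U' x)⁻¹ = ε • ((U x)⁻¹ * diagOf (R x)) := by
    refine Matrix.inv_eq_left_inv ?_
    rw [smul_mul_assoc, mul_assoc, e4, mul_smul_comm, Matrix.nonsing_inv_mul _ (jU x), smul_smul, hεε, one_smul]
  rw [diagOfL_apply, diagOfL_apply] at dDv
  have k1 : diagOf (R x) * Λ * U' x = ε • (Λ₀ * U x) + diagOf (fderiv ℝ R x v) * U' x := by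
    rw [sub_eq_iff_eq_add] at key
    rw [key, add_mul, mul_assoc, e4, mul_smul_comm]
  have k2 : diagOf (R x) * fderiv ℝ U' x v = ε • fderiv ℝ U x v - diagOf (fderiv ℝ R x v) * U' x := by
    rw [← dDv, add_sub_cancel_right]
  have k3 : ∀ X Z : Matrix (Fin 2) (Fin 2) ℂ, (U x)⁻¹ * diagOf (R x) * X * Z =
      (U x)⁻¹ * (diagOf (R x) * X * Z) := fun X Z => by simp only [mul_assoc]
  rw [hUinv, smul_mul_assoc, smul_mul_assoc, smul_mul_assoc, k3, mul_assoc (U x)⁻¹ _ (fderiv ℝ U' x v),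
    k1, k2, ← smul_add, ← mul_add, add_add_sub_cancel, ← smul_add, mul_smul_comm, smul_smul, hεε,
    one_smul, mul_add, mul_assoc]

/-- The connection form of `A_{χ, s μ₀}` on `P_χ`: the 1-form whose pull-back to
`SL(2, ℝ) × SU(2)` is `k⁻¹ λ(g⁻¹ dg) k + k⁻¹ dk`, where `λ = χ_* + s μ₀`. -/
def homConnection (s : ℝ) : OneForm P (Matrix (Fin 2) (Fin 2) ℂ) :=
  OneForm.descend P.quot P.quot_surjective (upForm s) (upForm_eq s)

theorem P.dSmooth_quot : DSmooth P.quot := dSmooth_quotient P.quot P.quot_surjective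

theorem pullback_homConnection (s : ℝ) :
    (homConnection s).pullback P.quot P.dSmooth_quot = upForm s :=
  OneForm.pullback_descend P.quot P.quot_surjective (upForm s) (upForm_eq s)

/-! ### Hyperbolic space, its frame bundle and its Levi-Civita connection -/

section Christoffel

variable {n : ℕ} (g : E n → Matrix (Fin n) (Fin n) ℝ)

/-- The partial derivative `∂ᵢ g_{jk}` at `x`. -/
def partialDeriv (i j k : Fin n) (x : E n) : ℝ :=
  fderiv ℝ (fun y => g y j k) x (EuclideanSpace.single i 1)

/-- The Christoffel symbol `Γᵏ_{ij}` of the metric `g` at `x`. -/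
def christoffel (i j k : Fin n) (x : E n) : ℝ :=
  (1 / 2) * ∑ l, (g x)⁻¹ k l *
    (partialDeriv g i j l x + partialDeriv g j i l x - partialDeriv g l i j x)

/-- The connection matrix of the Levi-Civita connection in the coordinate frame: the 1-form
`u ↦ (∑ᵢ uᵢ Γᵏ_{ij})_{kj}`. -/
def christoffelForm (x : E n) : E n →L[ℝ] Matrix (Fin n) (Fin n) ℝ :=
  ∑ i, (EuclideanSpace.proj i : E n →L[ℝ] ℝ).smulRight
    (Matrix.of fun k j => christoffel g i j k x)

end Christoffel

/-- The hyperbolic metric `x₃⁻² (dx₁² + dx₂² + dx₃²)`, as a matrix. -/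
def hypMetric (x : E 3) : Matrix (Fin 3) (Fin 3) ℝ := (x 2 ^ 2)⁻¹ • 1

/-- The upper half space model of hyperbolic space. -/
abbrev H3 : Type := {x : E 3 // 0 < x 2}

/-- The bundle `SO(H³)` of oriented orthonormal frames: pairs of a point and a matrix whose
columns are a positively oriented orthonormal basis of the tangent space. -/
structure FrameBundle where
  /-- the base point -/
  base : H3
  /-- the matrix whose columns are the vectors of the frame -/
  frame : Matrix (Fin 3) (Fin 3) ℝ
  orthonormal : frameᵀ * hypMetric base * frame = 1
  oriented : 0 < frame.det

namespace FrameBundle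

/-- `SO(H³)` is a submanifold of `ℝ³ × M₃(ℝ)`. -/
instance : DiffeologicalSpace FrameBundle :=
  embeddedDiffeology (fun y => ((y.base : E 3), y.frame))

/-- The right action of `SO(3)` on frames. -/
def act (y : FrameBundle) (R : SO3) : FrameBundle where
  base := y.base
  frame := y.frame * (R : Matrix (Fin 3) (Fin 3) ℝ)
  orthonormal := by
    have h := (Matrix.mem_orthogonalGroup_iff' (Fin 3) ℝ).1
      (Matrix.mem_specialOrthogonalGroup_iff.1 R.2).1
    rw [Matrix.transpose_mul]
    calc _ = (R : Matrix (Fin 3) (Fin 3) ℝ)ᵀ * (y.frameᵀ * hypMetric y.base * y.frame) * (R : Matrix (Fin 3) (Fin 3) ℝ) := by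
          simp only [mul_assoc]
      _ = 1 := by rw [y.orthonormal, mul_one]; exact h
  oriented := by
    rw [Matrix.det_mul, (Matrix.mem_specialOrthogonalGroup_iff.1 R.2).2, mul_one]
    exact y.oriented

theorem isUnit (y : FrameBundle) : IsUnit y.frame :=
  (Matrix.isUnit_iff_isUnit_det _).2 y.oriented.ne'.isUnit

theorem isPlot_iff {n : ℕ} {p : E n → FrameBundle} : IsPlot p ↔
    ContDiff ℝ ∞ (fun y => (((p y).base : E 3), (p y).frame)) := Iff.rfl

end FrameBundle

theorem contDiffOn_christoffelForm : ContDiffOn ℝ ∞ (christoffelForm hypMetric) {x : E 3 | 0 < x 2} := by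
  have hopen : IsOpen {x : E 3 | 0 < x 2} :=
    isOpen_lt continuous_const (EuclideanSpace.proj (𝕜 := ℝ) (2 : Fin 3)).continuous
  have h2 : ContDiff ℝ ∞ (fun x : E 3 => x 2) := (EuclideanSpace.proj (𝕜 := ℝ) (2 : Fin 3)).contDiff
  have hg : ∀ j k, ContDiffOn ℝ ∞ (fun x => hypMetric x j k) {x : E 3 | 0 < x 2} := by
    intro j k
    have h3 : ContDiffOn ℝ ∞ (fun x : E 3 => (x 2 ^ 2)⁻¹) {x : E 3 | 0 < x 2} :=
      (h2.pow 2).contDiffOn.inv fun x hx => (pow_pos hx 2).ne'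
    exact h3.mul contDiffOn_const
  have hp : ∀ i j k, ContDiffOn ℝ ∞ (partialDeriv hypMetric i j k) {x : E 3 | 0 < x 2} := by
    intro i j k
    exact ((hg j k).fderiv_of_isOpen hopen (m := ∞) (by simp)).clm_apply contDiffOn_const
  have hi : ∀ k l, ContDiffOn ℝ ∞ (fun x => (hypMetric x)⁻¹ k l) {x : E 3 | 0 < x 2} := by
    intro k l
    refine (((h2.pow 2).mul contDiff_const).contDiffOn (f := fun x : E 3 => x 2 ^ 2 * (1 : Matrix (Fin 3) (Fin 3) ℝ) k l)).congr fun x hx => ?_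
    have : (hypMetric x)⁻¹ = (x 2 ^ 2) • (1 : Matrix (Fin 3) (Fin 3) ℝ) := by
      refine Matrix.inv_eq_left_inv ?_
      rw [hypMetric, smul_mul_smul_comm, mul_one, mul_inv_cancel₀ (pow_pos hx 2).ne', one_smul]
    rw [this]
    rfl
  have hc : ∀ i j k, ContDiffOn ℝ ∞ (christoffel hypMetric i j k) {x : E 3 | 0 < x 2} := by
    intro i j k
    refine contDiffOn_const.mul (ContDiffOn.sum fun l _ => (hi k l).mul ?_)
    exact ((hp i j l).add (hp j i l)).sub (hp l i j)
  refine ContDiffOn.sum fun i _ => ?_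
  have hm : ContDiffOn ℝ ∞ (fun x => (Matrix.of fun k j => christoffel hypMetric i j k x :
      Matrix (Fin 3) (Fin 3) ℝ)) {x : E 3 | 0 < x 2} := by
    have : ∀ x, (Matrix.of fun k j => christoffel hypMetric i j k x : Matrix (Fin 3) (Fin 3) ℝ) =
        ∑ k, ∑ j, christoffel hypMetric i j k x • Matrix.single k j (1 : ℝ) := by
      intro x
      rw [Matrix.matrix_eq_sum_single (Matrix.of fun k j => christoffel hypMetric i j k x)]
      simp
    simp only [this]
    exact ContDiffOn.sum fun k _ => ContDiffOn.sum fun j _ => (hc i j k).smul contDiffOn_const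
  exact contDiffOn_const.smulRight hm

/-- The Levi-Civita connection form `F⁻¹ (dF + Γ(dx) F)` on `SO(H³)`, with values in `so(3)`. -/
def leviCivita : OneForm FrameBundle (Matrix (Fin 3) (Fin 3) ℝ) where
  toFun p _ x :=
    let b := fun y => ((p y).base : E 3)
    let F := fun y => (p y).frame
    (ContinuousLinearMap.mul ℝ _ (F x)⁻¹).comp
      (fderiv ℝ F x + ((ContinuousLinearMap.mul ℝ _).flip (F x)).comp
        ((christoffelForm hypMetric (b x)).comp (fderiv ℝ b x)))
  smooth p hp := by
    have hb : ContDiff ℝ ∞ (fun y => ((p y).base : E 3)) := (FrameBundle.isPlot_iff.1 hp).fst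
    have hF : ContDiff ℝ ∞ (fun y => (p y).frame) := (FrameBundle.isPlot_iff.1 hp).snd
    have hF' := contDiff_inv_real hF (fun x => (p x).isUnit)
    have db := hb.fderiv_right (m := ∞) (by simp)
    have dF := hF.fderiv_right (m := ∞) (by simp)
    have hG : ContDiff ℝ ∞ (fun y => christoffelForm hypMetric ((p y).base : E 3)) :=
      contDiffOn_univ.1 (contDiffOn_christoffelForm.comp hb.contDiffOn fun y _ => (p y).base.2)
    refine ContDiff.clm_comp ?_ (ContDiff.add dF (ContDiff.clm_comp ?_ (ContDiff.clm_comp hG db)))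
    · exact (ContinuousLinearMap.contDiff _).comp hF'
    · exact (ContinuousLinearMap.contDiff _).comp hF
  reparam p hp f hf x := by
    have hb : ContDiff ℝ ∞ (fun y => ((p y).base : E 3)) := (FrameBundle.isPlot_iff.1 hp).fst
    have hF : ContDiff ℝ ∞ (fun y => (p y).frame) := (FrameBundle.isPlot_iff.1 hp).snd
    have cb := fderiv_comp (g := fun y => ((p y).base : E 3)) x
      (hb.differentiable (by simp) (f x)) (hf.differentiable (by simp) x)
    have cF := fderiv_comp (g := fun y => (p y).frame) x
      (hF.differentiable (by simp) (f x)) (hf.differentiable (by simp) x)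
    simp only [Function.comp_def] at cb cF ⊢
    rw [cb, cF]
    ext v
    rfl

/-! ### The equidistant surfaces and the pulled back frame bundle -/

/-- The matrix `F^t`. -/
def flowMatrix (t : ℝ) : Matrix (Fin 3) (Fin 3) ℝ :=
  !![1, 0, Real.tanh t; 0, 1, 0; 0, 0, (Real.cosh t)⁻¹]

/-- The diffeomorphism `f_t` of `H³` induced by the matrix `F^t`. -/
def flow (t : ℝ) (x : H3) : H3 :=
  ⟨WithLp.toLp 2 (flowMatrix t *ᵥ x.1.ofLp), by
    have := mul_pos (inv_pos.2 (Real.cosh_pos t)) x.2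
    simpa [flowMatrix, Matrix.mulVec, dotProduct, Fin.sum_univ_three] using this⟩

/-- The embedding `φ_t : H² → H³`, `(x₁, x₂) ↦ f_t(0, x₁, x₂)`. -/
def phi (t : ℝ) (z : UpperHalfPlane) : H3 := flow t ⟨!₂[0, z.re, z.im], z.im_pos⟩

/-- The pull-back `φ_t^* SO(H³)`, a principal `SO(3)`-bundle over the upper half plane. -/
structure PulledFrames (t : ℝ) where
  /-- the base point -/
  base : UpperHalfPlane
  /-- the frame at the image of the base point -/
  point : FrameBundle
  base_eq : point.base = phi t base

namespace PulledFrames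

variable {t : ℝ}

/-- `φ_t^* SO(H³)` is a submanifold of `H² × SO(H³)`. -/
instance : DiffeologicalSpace (PulledFrames t) :=
  embeddedDiffeology (fun y => ((y.base : ℂ), (y.point.base : E 3), y.point.frame))

/-- The right action of `SO(3)`. -/
def act (y : PulledFrames t) (R : SO3) : PulledFrames t := ⟨y.base, y.point.act R, y.base_eq⟩

theorem isPlot_iff {n : ℕ} {p : E n → PulledFrames t} : IsPlot p ↔ ContDiff ℝ ∞
    (fun y => (((p y).base : ℂ), ((p y).point.base : E 3), (p y).point.frame)) := Iff.rfl

theorem dSmooth_point : DSmooth (point : PulledFrames t → FrameBundle) :=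
  fun _ _ hp => (isPlot_iff.1 hp).snd

end PulledFrames

/-- The pull-back `φ_t^* B_LC` of the Levi-Civita connection. -/
def pulledLeviCivita (t : ℝ) : OneForm (PulledFrames t) (Matrix (Fin 3) (Fin 3) ℝ) :=
  leviCivita.pullback PulledFrames.point PulledFrames.dSmooth_point

/-- The differential at `i` of `φ_t ∘ g : H² → H³`, for `g` in `PSL(2, ℝ)`, applied to `w`. -/
def pushForward (t : ℝ) (g : PSL(2, ℝ)) (w : ℂ) : E 3 :=
  fderiv ℝ (fun z : ℂ => (phi t (moebius g (UpperHalfPlane.ofComplex z)) : E 3)) Complex.I w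

end HypConn

end

/-! The isomorphism is `[A, U] ↦ F_A Ad(U)`. Here `F_A` is the oriented orthonormal frame at `φ_t(A
• i)` whose first two vectors are the images of `1`, `i` under the differential of `φ_t ∘ A`,
divided by `cosh t`, and whose third is the unit normal of `H_t`. The division is needed because
`φ_t` multiplies hyperbolic lengths by `cosh t`. Since the derivative of `A` at `i` is `1 / (ci +
d)²`, with `(c, d)` the second row of `A`, the frame is an explicit rational expression in `c`, `d`
(`frameMatrix`).

Right multiplication of `A` by an element of `H` multiplies `1 / (ci + d)²` by the value of `σ`,
hence rotates `F_A` about the normal exactly by `Ad ∘ χ` (`frameMatrix_mul_stab`). Together with the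
injectivity of `Ad` on `PU(2)`, this shows that the lifted map has the same fibres as `P.quot`
(`liftedFrame_eq_iff`). It is onto because `SL(2, ℝ)` acts transitively and `SU(2) → SO(3)` is
surjective. The inverse is smooth because the triangular matrices give a smooth section over the
half plane and the covering `SU(2) → SO(3)` has smooth local sections
(`exists_contDiff_lift_adMatrix`).

For the connections, the tangential part of the Levi-Civita form along `F_A` is the Levi-Civita form
of the plane itself, unchanged by the constant scaling `cosh t`; this is the contribution of `χ_*`.
The surface is umbilic with principal curvatures of absolute value `|tanh t|`, and the frame vectors
have been rescaled by `cosh t`, so the normal part has coefficient `cosh t · tanh t = sinh t`; this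
is `sinh(t) μ₀`. The resulting identity `F⁻¹(dF + ΓF) = ad(λ(A⁻¹dA))` is `fderiv_frameMatrix_add`.
Passing from `F_A` to `F_A Ad(U)` changes both forms by the same gauge rule, because `d Ad(U) =
Ad(U) ad(U⁻¹dU)` and `Ad(U) ad(U⁻¹ZU) = ad(Z) Ad(U)`. -/

noncomputable section

namespace HypConn

/-! ### The covering `SU(2) → SO(3)` -/

/-- The quaternion `p + q i + r j + s k` as a complex matrix. -/
def quaternionMatrix (p q r s : ℝ) : Matrix (Fin 2) (Fin 2) ℂ :=
  !![(p : ℂ) + q * Complex.I, (r : ℂ) + s * Complex.I;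
    -(r : ℂ) + s * Complex.I, (p : ℂ) - q * Complex.I]

/-- The rotation induced by the unit quaternion `p + q i + r j + s k`. -/
def eulerRodrigues (p q r s : ℝ) : Matrix (Fin 3) (Fin 3) ℝ :=
  !![p * p - q * q - r * r + s * s, -2 * p * q - 2 * r * s, -2 * p * r + 2 * q * s;
    2 * p * q - 2 * r * s, p * p - q * q + r * r - s * s, -2 * p * s - 2 * q * r;
    2 * p * r + 2 * q * s, 2 * p * s - 2 * q * r, p * p + q * q - r * r - s * s]

theorem quaternionMatrix_mem {p q r s : ℝ} (h : p ^ 2 + q ^ 2 + r ^ 2 + s ^ 2 = 1) :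
    quaternionMatrix p q r s ∈ Matrix.specialUnitaryGroup (Fin 2) ℂ := by
  refine Matrix.mem_specialUnitaryGroup_iff.2 ⟨Matrix.mem_unitaryGroup_iff.2 ?_, ?_⟩
  · ext i j
    apply Complex.ext <;> fin_cases i <;> fin_cases j <;>
      simp [quaternionMatrix, Matrix.mul_apply, Fin.sum_univ_two, Matrix.star_apply] <;>
      first
        | ring1
        | linear_combination h
  · rw [quaternionMatrix, Matrix.det_fin_two_of]
    apply Complex.ext <;> simp
    · linear_combination h
    · ring

theorem star_quaternionMatrix (p q r s : ℝ) :
    star (quaternionMatrix p q r s) = quaternionMatrix p (-q) (-r) (-s) := by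
  ext i j
  apply Complex.ext <;> fin_cases i <;> fin_cases j <;>
    simp [quaternionMatrix, Matrix.star_apply]

theorem adMatrix_of_eq_quaternionMatrix {U : SU2} {p q r s : ℝ}
    (h : (U : Matrix (Fin 2) (Fin 2) ℂ) = quaternionMatrix p q r s) :
    adMatrix U = eulerRodrigues p q r s := by
  ext i j
  rw [adMatrix, Matrix.of_apply, h, star_quaternionMatrix]
  fin_cases i <;> fin_cases j <;>
    simp [eulerRodrigues, quaternionMatrix, coord, aBasis, Matrix.trace_fin_two] <;> ring

theorem SU2.exists_eq_quaternionMatrix (U : SU2) : ∃ p q r s : ℝ,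
    p ^ 2 + q ^ 2 + r ^ 2 + s ^ 2 = 1 ∧
      (U : Matrix (Fin 2) (Fin 2) ℂ) = quaternionMatrix p q r s := by
  obtain ⟨h1, h2⟩ := SU2.entries U
  have hdet : Matrix.det (U : Matrix (Fin 2) (Fin 2) ℂ) = 1 :=
    (Matrix.mem_specialUnitaryGroup_iff.1 U.2).2
  rw [Matrix.det_fin_two, h1, h2] at hdet
  refine ⟨(U.1 0 0).re, (U.1 0 0).im, (U.1 0 1).re, (U.1 0 1).im, ?_, ?_⟩
  · have := congrArg Complex.re hdet
    simp at this
    linarith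
  · rw [Matrix.eta_fin_two (U : Matrix (Fin 2) (Fin 2) ℂ), h1, h2]
    ext i j
    apply Complex.ext <;> fin_cases i <;> fin_cases j <;> simp [quaternionMatrix]

/-- The diagonal entries alone decide: if all three equal `1`, comparison with the norm equation
forces `q = r = s = 0`, so `p = ±1`, and the kernel is exactly the subgroup divided out. -/
theorem Ad_injective : Function.Injective Ad := by
  refine (injective_iff_map_eq_one Ad).2 fun k hk => ?_
  induction k using QuotientGroup.induction_on with
  | H U =>
  have h1 : adMatrix U = 1 := by rw [← Ad_mk, hk]; rfl
  obtain ⟨p, q, r, s, hn, hU⟩ := U.exists_eq_quaternionMatrix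
  rw [adMatrix_of_eq_quaternionMatrix hU] at h1
  have e0 := congrFun (congrFun h1 0) 0
  have e1 := congrFun (congrFun h1 1) 1
  have e2 := congrFun (congrFun h1 2) 2
  simp [eulerRodrigues] at e0 e1 e2
  have hq : q = 0 := by nlinarith
  have hr : r = 0 := by nlinarith
  have hs : s = 0 := by nlinarith
  subst hq hr hs
  have hp : (p - 1) * (p + 1) = 0 := by linear_combination hn
  rw [← QuotientGroup.mk_one, eq_comm, PU2.mk_eq_iff, hU]
  rcases mul_eq_zero.1 hp with h | h
  · obtain rfl : p = 1 := by linarith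
    left
    ext i j
    fin_cases i <;> fin_cases j <;> simp [quaternionMatrix]
  · obtain rfl : p = -1 := by linarith
    right
    ext i j
    fin_cases i <;> fin_cases j <;> simp [quaternionMatrix]

/-- The components of the unit quaternion with positive real part that induces the rotation `R`. -/
def quaternionOf (R : Matrix (Fin 3) (Fin 3) ℝ) : Fin 4 → ℝ :=
  ![√(1 + R.trace) / 2, (R 1 0 - R 0 1) / (2 * √(1 + R.trace)),
    (R 2 0 - R 0 2) / (2 * √(1 + R.trace)), (R 2 1 - R 1 2) / (2 * √(1 + R.trace))]

/-- In `eulerRodrigues p q r s` with unit norm, `1 + trace = 4p²` and the antisymmetric part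
consists of `4pq`, `4pr`, `4ps`. When the trace exceeds `-1` one can therefore divide by `p`. It
remains to see that the quotients reproduce the symmetric part and have norm one. -/
theorem quaternionOf_spec {R : Matrix (Fin 3) (Fin 3) ℝ}
    (hR : R ∈ Matrix.specialOrthogonalGroup (Fin 3) ℝ) (ht : 0 < 1 + R.trace) :
    (quaternionOf R 0 ^ 2 + quaternionOf R 1 ^ 2 + quaternionOf R 2 ^ 2 + quaternionOf R 3 ^ 2 = 1) ∧
      eulerRodrigues (quaternionOf R 0) (quaternionOf R 1) (quaternionOf R 2) (quaternionOf R 3) =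
        R := by
  obtain ⟨ho, hd⟩ := Matrix.mem_specialOrthogonalGroup_iff.1 hR
  have h1 : R * Rᵀ = 1 := (Matrix.mem_orthogonalGroup_iff (Fin 3) ℝ).1 ho
  have h2 : Rᵀ * R = 1 := (Matrix.mem_orthogonalGroup_iff' (Fin 3) ℝ).1 ho
  -- Determinant one enters here: each cofactor equals the corresponding entry, a quadratic relation
  -- that orthogonality alone gives only up to sign.
  have h3 : R.adjugate = Rᵀ := by
    have h4 := Matrix.adjugate_mul R
    rw [hd, one_smul] at h4
    calc _ = R.adjugate * (R * Rᵀ) := by rw [h1, mul_one]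
      _ = _ := by rw [← mul_assoc, h4, one_mul]
  obtain ⟨w, hw, hw2⟩ : ∃ w : ℝ, 0 < w ∧ w ^ 2 = 1 + R.trace :=
    ⟨√(1 + R.trace), Real.sqrt_pos.2 ht, Real.sq_sqrt ht.le⟩
  have hsq : √(1 + R.trace) = w := by rw [← hw2, Real.sqrt_sq hw.le]
  simp only [quaternionOf, hsq, Matrix.cons_val]
  have hw0 := hw.ne'
  have r0 := fun i j => congrFun (congrFun h1 i) j
  have c0 := fun i j => congrFun (congrFun h2 i) j
  have a0 := fun i j => congrFun (congrFun h3 i) j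
  simp only [Matrix.mul_apply, Fin.sum_univ_three, Matrix.transpose_apply] at r0 c0
  rw [Matrix.adjugate_fin_three] at a0
  have r00 := r0 0 0
  have r11 := r0 1 1
  have r22 := r0 2 2
  have r01 := r0 0 1
  have r02 := r0 0 2
  have r12 := r0 1 2
  have c00 := c0 0 0
  have c11 := c0 1 1
  have c22 := c0 2 2
  have c01 := c0 0 1
  have c02 := c0 0 2
  have c12 := c0 1 2
  have a00 := a0 0 0
  have a01 := a0 0 1
  have a02 := a0 0 2
  have a10 := a0 1 0
  have a11 := a0 1 1
  have a12 := a0 1 2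
  have a20 := a0 2 0
  have a21 := a0 2 1
  have a22 := a0 2 2
  clear r0 c0 a0 h1 h2 h3 ho hd hR ht hsq
  simp at r00 r11 r22 r01 r02 r12 c00 c11 c22 c01 c02 c12 a00 a01 a02 a10 a11 a12 a20 a21 a22
  rw [Matrix.trace_fin_three] at hw2
  obtain ⟨T, hT⟩ : ∃ T, T = 1 + (R 0 0 + R 1 1 + R 2 2) := ⟨_, rfl⟩
  have hT0 : T ≠ 0 := by rw [hT, ← hw2]; positivity
  rw [← hT] at hw2
  generalize hd1 : R 1 0 - R 0 1 = d1
  generalize hd2 : R 2 0 - R 0 2 = d2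
  generalize hd3 : R 2 1 - R 1 2 = d3
  -- These are the relations `(4pr)(4ps) = 4p² · 4rs` and their analogues, written in the entries of
  -- `R`. Once the products of entries are treated as unknowns, they are linear consequences of the
  -- orthonormality of rows and columns and of the cofactor relations.
  have k23 : d2 * d3 = T * -(R 1 0 + R 0 1) := by rw [hT, ← hd2, ← hd3]; linarith
  have k13 : d1 * d3 = T * (R 2 0 + R 0 2) := by rw [hT, ← hd1, ← hd3]; linarith
  have k12 : d1 * d2 = T * -(R 2 1 + R 1 2) := by rw [hT, ← hd1, ← hd2]; linarith
  have k11 : d1 * d1 = T * (1 + R 2 2 - R 0 0 - R 1 1) := by rw [hT, ← hd1]; linarith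
  have k22 : d2 * d2 = T * (1 + R 1 1 - R 0 0 - R 2 2) := by rw [hT, ← hd2]; linarith
  have k33 : d3 * d3 = T * (1 + R 0 0 - R 1 1 - R 2 2) := by rw [hT, ← hd3]; linarith
  clear r00 r11 r22 r01 r02 r12 c00 c11 c22 c01 c02 c12 a00 a01 a02 a10 a11 a12 a20 a21 a22
  -- All products of two of the quaternion components are now evaluated as linear expressions in the
  -- entries of `R`, so both claims become linear.
  have hp : w / 2 * (w / 2) = T / 4 := by rw [← hw2]; ring
  have hpd : ∀ d, w / 2 * (d / (2 * w)) = d / 4 := fun d => by field_simp; ring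
  have hdd : ∀ {d d' m : ℝ}, d * d' = T * m → d / (2 * w) * (d' / (2 * w)) = m / 4 := by
    intro d d' m h
    rw [div_mul_div_comm, h, mul_mul_mul_comm, ← sq w, hw2]
    field_simp
    norm_num
  have h1 := hpd d1
  have h2 := hpd d2
  have h3 := hpd d3
  have m11 := hdd k11
  have m12 := hdd k12
  have m13 := hdd k13
  have m22 := hdd k22
  have m23 := hdd k23
  have m33 := hdd k33
  clear hdd hpd k23 k13 k12 k11 k22 k33
  generalize w / 2 = p at *
  generalize d1 / (2 * w) = q at *
  generalize d2 / (2 * w) = r at *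
  generalize d3 / (2 * w) = s at *
  constructor
  · linarith
  · ext i j
    fin_cases i <;> fin_cases j <;> simp [eulerRodrigues] <;> linarith

/-- Every rotation becomes a rotation of trace greater than `-1` after a multiplication by a
rotation that comes from `SU(2)`. -/
theorem exists_trace_pos (R : Matrix (Fin 3) (Fin 3) ℝ) :
    ∃ U : SU2, 0 < 1 + (R * adMatrix U).trace := by
  have key : ∀ {p q r s : ℝ}, p ^ 2 + q ^ 2 + r ^ 2 + s ^ 2 = 1 →
      0 < 1 + (R * eulerRodrigues p q r s).trace → ∃ U : SU2, 0 < 1 + (R * adMatrix U).trace := by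
    intro p q r s hn h
    exact ⟨⟨_, quaternionMatrix_mem hn⟩, by rwa [adMatrix_of_eq_quaternionMatrix rfl]⟩
  by_contra! hc
  have hc' : ∀ {p q r s : ℝ}, p ^ 2 + q ^ 2 + r ^ 2 + s ^ 2 = 1 →
      1 + (R * eulerRodrigues p q r s).trace ≤ 0 := by
    intro p q r s hn
    by_contra! h
    obtain ⟨U, hU⟩ := key hn h
    exact absurd (hc U) (not_le.2 hU)
  -- The rotations of the quaternions `1, i, j, k` are diagonal with sum zero. The four quantities
  -- `1 + trace` thus add up to `4` and cannot all be nonpositive.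
  have h1 := hc' (p := 1) (q := 0) (r := 0) (s := 0) (by norm_num)
  have h2 := hc' (p := 0) (q := 1) (r := 0) (s := 0) (by norm_num)
  have h3 := hc' (p := 0) (q := 0) (r := 1) (s := 0) (by norm_num)
  have h4 := hc' (p := 0) (q := 0) (r := 0) (s := 1) (by norm_num)
  simp [Matrix.trace_fin_three, Matrix.mul_apply, Fin.sum_univ_three, eulerRodrigues]
    at h1 h2 h3 h4
  linarith

/-- Half-turns have trace `-1` and escape the explicit formula; they are reached by first
multiplying by a suitable `adMatrix V` and then undoing it. -/
theorem exists_adMatrix_eq {R : Matrix (Fin 3) (Fin 3) ℝ}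
    (hR : R ∈ Matrix.specialOrthogonalGroup (Fin 3) ℝ) : ∃ U : SU2, adMatrix U = R := by
  obtain ⟨V, hV⟩ := exists_trace_pos R
  obtain ⟨hn, hq⟩ := quaternionOf_spec (mul_mem hR (adMatrix_mem V)) hV
  refine ⟨⟨_, quaternionMatrix_mem hn⟩ * V⁻¹, ?_⟩
  have hV1 : adMatrix V * adMatrix V⁻¹ = 1 := by
    rw [← adMatrix_mul, mul_inv_cancel, ← Ad_mk, QuotientGroup.mk_one, map_one]
    rfl
  rw [adMatrix_mul, adMatrix_of_eq_quaternionMatrix rfl, hq, mul_assoc, hV1, mul_one]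

/-! ### Smooth local sections of the covering -/

theorem contDiff_matrix_iff {n k l : ℕ} {f : E n → Matrix (Fin k) (Fin l) ℝ} :
    ContDiff ℝ ∞ f ↔ ∀ i j, ContDiff ℝ ∞ (fun y => f y i j) := by
  constructor
  · intro h i j
    exact (LinearMap.toContinuousLinearMap (Matrix.entryLinearMap ℝ ℝ i j)).contDiff.comp h
  · intro h
    have : f = fun y => ∑ i, ∑ j, f y i j • Matrix.single i j (1 : ℝ) := by
      funext y
      conv_lhs => rw [Matrix.matrix_eq_sum_single (f y)]
      simp
    rw [this]
    exact ContDiff.sum fun i _ => ContDiff.sum fun j _ => (h i j).smul contDiff_const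

theorem contDiff_matrix_complex {n k l : ℕ} {f : E n → Matrix (Fin k) (Fin l) ℂ}
    (h : ∀ i j, ContDiff ℝ ∞ (fun y => f y i j)) : ContDiff ℝ ∞ f := by
  have : f = fun y => ∑ i, ∑ j, f y i j • Matrix.single i j (1 : ℂ) := by
    funext y
    conv_lhs => rw [Matrix.matrix_eq_sum_single (f y)]
    simp
  rw [this]
  exact ContDiff.sum fun i _ => ContDiff.sum fun j _ => (h i j).smul contDiff_const

/-- The homomorphism `SU(2) → SO(3)` has smooth local sections. -/
theorem exists_contDiff_lift_adMatrix {n : ℕ} {f : E n → Matrix (Fin 3) (Fin 3) ℝ}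
    (hf : ContDiff ℝ ∞ f) (hR : ∀ y, f y ∈ Matrix.specialOrthogonalGroup (Fin 3) ℝ) (x : E n) :
    ∃ U : E n → SU2, ContDiff ℝ ∞ (fun y => (U y : Matrix (Fin 2) (Fin 2) ℂ)) ∧
      ∀ᶠ y in 𝓝 x, adMatrix (U y) = f y := by
  obtain ⟨V, hV⟩ := exists_trace_pos (f x)
  have hg : ContDiff ℝ ∞ (fun y => f y * adMatrix V) := hf.mul contDiff_const
  have htr : ContDiff ℝ ∞ (fun y => 1 + (f y * adMatrix V).trace) := by
    simp only [Matrix.trace_fin_three]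
    have := contDiff_matrix_iff.1 hg
    exact contDiff_const.add (((this 0 0).add (this 1 1)).add (this 2 2))
  -- A plot must be defined on all of `E n`, while the quaternion formula is smooth only where the
  -- trace exceeds `-1`. Precomposing with `c` keeps the argument in that open set and changes
  -- nothing near `x`.
  obtain ⟨c, hc, hcu, hcx⟩ := exists_cutoff x (isOpen_lt continuous_const htr.continuous) hV
  have hspec := fun y => quaternionOf_spec (mul_mem (hR (c y)) (adMatrix_mem V)) (hcu y)
  have hV1 : adMatrix V * adMatrix V⁻¹ = 1 := by
    rw [← adMatrix_mul, mul_inv_cancel, ← Ad_mk, QuotientGroup.mk_one, map_one]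
    rfl
  refine ⟨fun y => ⟨_, quaternionMatrix_mem (hspec y).1⟩ * V⁻¹, ?_, ?_⟩
  · have hgc := contDiff_matrix_iff.1 (hg.comp hc)
    have hs : ContDiff ℝ ∞ (fun y => √(1 + (f (c y) * adMatrix V).trace)) :=
      (htr.comp hc).sqrt fun y => (hcu y).ne'
    have hs0 : ∀ y, 2 * √(1 + (f (c y) * adMatrix V).trace) ≠ 0 := fun y =>
      mul_ne_zero two_ne_zero (Real.sqrt_pos.2 (hcu y)).ne'
    have hq : ∀ i, ContDiff ℝ ∞ (fun y => quaternionOf (f (c y) * adMatrix V) i) := by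
      intro i
      fin_cases i
      · exact hs.div_const 2
      · exact ((hgc 1 0).sub (hgc 0 1)).div (contDiff_const.mul hs) hs0
      · exact ((hgc 2 0).sub (hgc 0 2)).div (contDiff_const.mul hs) hs0
      · exact ((hgc 2 1).sub (hgc 1 2)).div (contDiff_const.mul hs) hs0
    have hqc : ∀ i, ContDiff ℝ ∞ (fun y => (quaternionOf (f (c y) * adMatrix V) i : ℂ)) :=
      fun i => Complex.ofRealCLM.contDiff.comp (hq i)
    refine ContDiff.mul (contDiff_matrix_complex fun i j => ?_) contDiff_const
    fin_cases i <;> fin_cases j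
    · exact (hqc 0).add ((hqc 1).mul contDiff_const)
    · exact (hqc 2).add ((hqc 3).mul contDiff_const)
    · exact (hqc 2).neg.add ((hqc 3).mul contDiff_const)
    · exact (hqc 0).sub ((hqc 1).mul contDiff_const)
  · filter_upwards [hcx] with y hy
    rw [adMatrix_mul, adMatrix_of_eq_quaternionMatrix rfl, (hspec y).2, mul_assoc, hV1, mul_one, hy]

/-! ### The frame of `H³` adapted to an equidistant surface and an element of `SL(2, ℝ)` -/

theorem _root_.Matrix.SpecialLinearGroup.sq_add_sq_pos (A : SL(2, ℝ)) : 0 < A 1 0 ^ 2 + A 1 1 ^ 2 := by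
  have h := A.det_coe
  rw [Matrix.det_fin_two] at h
  by_contra! hc
  have h0 : A 1 0 = 0 := by nlinarith [sq_nonneg (A 1 0), sq_nonneg (A 1 1)]
  have h1 : A 1 1 = 0 := by nlinarith [sq_nonneg (A 1 0), sq_nonneg (A 1 1)]
  rw [h0, h1] at h
  simp at h

theorem coe_smul_I (A : SL(2, ℝ)) : ((A • UpperHalfPlane.I : UpperHalfPlane) : ℂ) =
    ((A 0 0 * A 1 0 + A 0 1 * A 1 1) / (A 1 0 ^ 2 + A 1 1 ^ 2) : ℝ) +
      ((A 1 0 ^ 2 + A 1 1 ^ 2)⁻¹ : ℝ) * Complex.I := by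
  have hN := A.sq_add_sq_pos.ne'
  have h := A.det_coe
  rw [Matrix.det_fin_two] at h
  rw [UpperHalfPlane.coe_specialLinearGroup_apply]
  simp only [UpperHalfPlane.coe_I, Algebra.algebraMap_self, RingHom.id_apply]
  have hne : (A 1 0 : ℂ) * Complex.I + A 1 1 ≠ 0 := by
    intro h
    have h2 := congrArg Complex.re h
    have h3 := congrArg Complex.im h
    simp at h2 h3
    simp [h2, h3] at hN
  obtain ⟨X, hX⟩ : ∃ X, X = (A 0 0 * A 1 0 + A 0 1 * A 1 1) / (A 1 0 ^ 2 + A 1 1 ^ 2) := ⟨_, rfl⟩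
  obtain ⟨Y, hY⟩ : ∃ Y, Y = (A 1 0 ^ 2 + A 1 1 ^ 2)⁻¹ := ⟨_, rfl⟩
  rw [div_eq_iff hne, ← hX, ← hY]
  apply Complex.ext
  · simp
    rw [hX, hY]
    field_simp
    linear_combination (-A 1 0) * h
  · simp
    rw [hX, hY]
    field_simp
    linear_combination A 1 1 * h

theorem re_smul_I (A : SL(2, ℝ)) : (A • UpperHalfPlane.I : UpperHalfPlane).re =
    (A 0 0 * A 1 0 + A 0 1 * A 1 1) / (A 1 0 ^ 2 + A 1 1 ^ 2) := by
  have := congrArg Complex.re (coe_smul_I A)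
  rw [← UpperHalfPlane.coe_re]
  simpa only [Complex.add_re, Complex.ofReal_re, Complex.re_ofReal_mul, Complex.I_re, mul_zero,
    add_zero] using this

theorem im_smul_I (A : SL(2, ℝ)) : (A • UpperHalfPlane.I : UpperHalfPlane).im =
    (A 1 0 ^ 2 + A 1 1 ^ 2)⁻¹ := by
  have := congrArg Complex.im (coe_smul_I A)
  rw [← UpperHalfPlane.coe_im]
  simpa only [Complex.add_im, Complex.ofReal_im, Complex.im_ofReal_mul, Complex.I_im, mul_one,
    zero_add] using this

theorem phi_coe (t : ℝ) (z : UpperHalfPlane) : ((phi t z : H3) : E 3) =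
    !₂[z.im * Real.tanh t, z.re, z.im / Real.cosh t] := by
  ext i
  fin_cases i <;>
    simp [phi, flow, flowMatrix, mul_comm, div_eq_mul_inv]

/-- The orthogonal matrix whose columns are the unit tangent and normal vectors of `H_t`. -/
def surfaceMatrix (t : ℝ) : Matrix (Fin 3) (Fin 3) ℝ :=
  !![Real.tanh t, 0, (Real.cosh t)⁻¹; 0, 1, 0; (Real.cosh t)⁻¹, 0, -Real.tanh t]

/-- The differential of a Möbius transformation with second row `(c, d)`, up to a factor, followed
by the exchange of the coordinates. -/
def rotationMatrix (c d : ℝ) : Matrix (Fin 3) (Fin 3) ℝ :=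
  !![-2 * c * d, d ^ 2 - c ^ 2, 0; d ^ 2 - c ^ 2, 2 * c * d, 0; 0, 0, c ^ 2 + d ^ 2]

/-- The frame at `φ_t(g • i)` whose first two vectors are the normalised images of `1`, `i` under
the differential of `φ_t ∘ g`, for `g` with second row `(c, d)`. -/
def frameMatrix (t c d : ℝ) : Matrix (Fin 3) (Fin 3) ℝ :=
  (Real.cosh t * (c ^ 2 + d ^ 2) ^ 2)⁻¹ • (surfaceMatrix t * rotationMatrix c d)

theorem inv_cosh_sq_add_tanh_sq (t : ℝ) : (Real.cosh t)⁻¹ ^ 2 + Real.tanh t ^ 2 = 1 := by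
  have h := Real.cosh_sq t
  have hc := (Real.cosh_pos t).ne'
  rw [Real.tanh_eq_sinh_div_cosh]
  field_simp
  linarith

theorem surfaceMatrix_transpose_mul (t : ℝ) : (surfaceMatrix t)ᵀ * surfaceMatrix t = 1 := by
  have h := inv_cosh_sq_add_tanh_sq t
  ext i j
  fin_cases i <;> fin_cases j <;>
    simp [surfaceMatrix, Matrix.mul_apply, Fin.sum_univ_three] <;> linarith

theorem rotationMatrix_transpose_mul (c d : ℝ) :
    (rotationMatrix c d)ᵀ * rotationMatrix c d = ((c ^ 2 + d ^ 2) ^ 2) • 1 := by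
  ext i j
  fin_cases i <;> fin_cases j <;>
    simp [rotationMatrix, Matrix.mul_apply, Fin.sum_univ_three] <;> ring

/-- The scalar on the right is the square of the third coordinate of `φ_t(A • i)`, so this is
orthonormality for the hyperbolic metric. -/
theorem frameMatrix_transpose_mul (t : ℝ) {c d : ℝ} (h : 0 < c ^ 2 + d ^ 2) :
    (frameMatrix t c d)ᵀ * frameMatrix t c d = ((c ^ 2 + d ^ 2)⁻¹ / Real.cosh t) ^ 2 • 1 := by
  have hc := (Real.cosh_pos t).ne'
  rw [frameMatrix, Matrix.transpose_smul, Matrix.transpose_mul, smul_mul_smul_comm, mul_assoc,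
    ← mul_assoc _ (surfaceMatrix t), surfaceMatrix_transpose_mul, one_mul,
    rotationMatrix_transpose_mul, smul_smul]
  congr 1
  field_simp

/-- Both factors exchange the two tangential directions and so reverse orientation; the signs
cancel. This is what fixes the sign of the normal in `surfaceMatrix`. -/
theorem det_frameMatrix_pos (t : ℝ) {c d : ℝ} (h : 0 < c ^ 2 + d ^ 2) :
    0 < (frameMatrix t c d).det := by
  have hc := Real.cosh_pos t
  have h1 : (surfaceMatrix t).det = -1 := by
    have h := inv_cosh_sq_add_tanh_sq t
    simp [surfaceMatrix, Matrix.det_fin_three]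
    linarith
  have h2 : (rotationMatrix c d).det = -(c ^ 2 + d ^ 2) ^ 3 := by
    simp [rotationMatrix, Matrix.det_fin_three]
    ring
  rw [frameMatrix, Matrix.det_smul, Matrix.det_mul, h1, h2]
  have : 0 < -1 * -(c ^ 2 + d ^ 2) ^ 3 := by
    rw [neg_one_mul, neg_neg]
    positivity
  positivity

/-- The adapted frame at `φ_t(A • i)`. -/
def adaptedFrame (t : ℝ) (A : SL(2, ℝ)) : FrameBundle where
  base := phi t (A • UpperHalfPlane.I)
  frame := frameMatrix t (A 1 0) (A 1 1)
  orthonormal := by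
    have hc := (Real.cosh_pos t).ne'
    have hN := A.sq_add_sq_pos.ne'
    rw [hypMetric, phi_coe, im_smul_I, mul_smul_comm, mul_one, smul_mul_assoc,
      frameMatrix_transpose_mul t A.sq_add_sq_pos, smul_smul]
    simp [hc, hN]
  oriented := det_frameMatrix_pos t A.sq_add_sq_pos

/-! ### The bundle isomorphism -/

theorem PulledFrames.ext_frame {t : ℝ} {y y' : PulledFrames t} (h : y.base = y'.base)
    (h' : y.point.frame = y'.point.frame) : y = y' := by
  obtain ⟨z, ⟨b, F, h1, h2⟩, h3⟩ := y
  obtain ⟨z', ⟨b', F', h1', h2'⟩, h3'⟩ := y'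
  dsimp only at h h' h3 h3'
  subst h h' h3 h3'
  rfl

/-- The map `(A, U) ↦ (A • i, F_A Ad(U))`. -/
def liftedFrame (t : ℝ) (x : SL(2, ℝ) × SU2) : PulledFrames t :=
  ⟨x.1 • UpperHalfPlane.I, (adaptedFrame t x.1).act (Ad (QuotientGroup.mk x.2)), rfl⟩

theorem liftedFrame_frame (t : ℝ) (x : SL(2, ℝ) × SU2) : (liftedFrame t x).point.frame =
    frameMatrix t (x.1 1 0) (x.1 1 1) * adMatrix x.2 := rfl

/-- If `R` has first row `(a, b)`, then `ci + d` is multiplied by the unit number `a - ib`, so the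
derivative `1 / (ci + d)²` is multiplied by `(a + ib)²`. The adjoint action of `diag(a + ib, a -
ib)` is the rotation of the `a₁a₂`-plane by the same angle. -/
theorem frameMatrix_mul_stab (t : ℝ) (A R : SL(2, ℝ)) (h : (QuotientGroup.mk R : PSL(2, ℝ)) ∈ stab)
    {D : SU2} (hD : (D : Matrix (Fin 2) (Fin 2) ℂ) = diagOf R) :
    frameMatrix t ((A * R) 1 0) ((A * R) 1 1) = frameMatrix t (A 1 0) (A 1 1) * adMatrix D := by
  obtain ⟨h1, h2⟩ := (mk_mem_stab_iff R).1 h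
  have h3 := stab_sq h
  have hD' : (D : Matrix (Fin 2) (Fin 2) ℂ) = quaternionMatrix (R 0 0) (R 0 1) 0 0 := by
    rw [hD, diagOf, quaternionMatrix]
    simp
  rw [adMatrix_of_eq_quaternionMatrix hD', frameMatrix, frameMatrix, smul_mul_assoc, mul_assoc]
  have hc : (A * R) 1 0 = A 1 0 * R 0 0 - A 1 1 * R 0 1 := by
    simp [Matrix.mul_apply, Fin.sum_univ_two, h1]
    ring
  have hd : (A * R) 1 1 = A 1 0 * R 0 1 + A 1 1 * R 0 0 := by
    simp [Matrix.mul_apply, Fin.sum_univ_two, h2]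
  have hN : (A * R) 1 0 ^ 2 + (A * R) 1 1 ^ 2 = A 1 0 ^ 2 + A 1 1 ^ 2 := by
    rw [hc, hd]
    linear_combination (A 1 0 ^ 2 + A 1 1 ^ 2) * h3
  rw [hN]
  congr 2
  rw [rotationMatrix, hN, hc, hd]
  ext i j
  fin_cases i <;> fin_cases j <;>
    simp [rotationMatrix, eulerRodrigues, Matrix.mul_apply, Fin.sum_univ_three] <;>
    first
      | ring1
      | linear_combination (-(A 1 0 ^ 2 + A 1 1 ^ 2)) * h3

theorem mk_inv_mul_mem_stab {A B : SL(2, ℝ)}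
    (h : A • UpperHalfPlane.I = B • UpperHalfPlane.I) :
    (QuotientGroup.mk (A⁻¹ * B) : PSL(2, ℝ)) ∈ stab := by
  change (A⁻¹ * B) • UpperHalfPlane.I = UpperHalfPlane.I
  rw [mul_smul, ← h, inv_smul_smul]

/-- Over the same base point the two `SL(2, ℝ)` components differ by an element of `H`. By
`frameMatrix_mul_stab` the common factor `F_A` can be cancelled, and what remains is an equation in
`SO(3)` that `Ad_injective` turns into the defining relation of `P`. -/
theorem liftedFrame_eq_iff (t : ℝ) (x y : SL(2, ℝ) × SU2) :
    liftedFrame t x = liftedFrame t y ↔ P.quot x = P.quot y := by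
  have key : ∀ h : (QuotientGroup.mk (x.1⁻¹ * y.1) : PSL(2, ℝ)) ∈ stab,
      (liftedFrame t x).point.frame = (liftedFrame t y).point.frame ↔
        (QuotientGroup.mk y.2 : PU2) = (chi ⟨_, h⟩)⁻¹ * QuotientGroup.mk x.2 := by
    intro h
    obtain ⟨D, hD, hD'⟩ := chi_mk _ h
    have hF := frameMatrix_mul_stab t x.1 (x.1⁻¹ * y.1) h hD
    rw [mul_inv_cancel_left] at hF
    have hu := (Matrix.isUnit_iff_isUnit_det _).2
      (det_frameMatrix_pos t x.1.sq_add_sq_pos).ne'.isUnit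
    rw [liftedFrame_frame, liftedFrame_frame, hF, mul_assoc, hu.mul_right_inj, ← adMatrix_mul,
      ← Ad_mk, ← Ad_mk, Subtype.coe_inj, Ad_injective.eq_iff, hD', QuotientGroup.mk_mul,
      eq_inv_mul_iff_mul_eq, eq_comm]
  constructor
  · intro h
    have hb : x.1 • UpperHalfPlane.I = y.1 • UpperHalfPlane.I :=
      congrArg PulledFrames.base h
    have hs := mk_inv_mul_mem_stab hb
    refine (P.mk_eq_iff _ _ _ _).2 ⟨⟨_, hs⟩, ?_, (key hs).1 (by rw [h])⟩
    change _ = QuotientGroup.mk x.1 * QuotientGroup.mk (x.1⁻¹ * y.1)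
    rw [← QuotientGroup.mk_mul, mul_inv_cancel_left]
  · intro h
    have hb : x.1 • UpperHalfPlane.I = y.1 • UpperHalfPlane.I := congrArg P.proj h
    obtain ⟨⟨g, hg⟩, h1, h2⟩ := (P.mk_eq_iff _ _ _ _).1 h
    obtain rfl : g = QuotientGroup.mk (x.1⁻¹ * y.1) := by
      rw [QuotientGroup.mk_mul, QuotientGroup.mk_inv, h1, inv_mul_cancel_left]
    exact PulledFrames.ext_frame hb ((key hg).2 h2)

/-- The upper triangular element of `SL(2, ℝ)` that maps `i` to `z`. -/
def triangular (z : UpperHalfPlane) : SL(2, ℝ) :=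
  ⟨!![√z.im, z.re / √z.im; 0, (√z.im)⁻¹], by
    have h := (Real.sqrt_pos.2 z.im_pos).ne'
    rw [Matrix.det_fin_two_of]
    field_simp
    simp⟩

theorem triangular_smul_I (z : UpperHalfPlane) : triangular z • UpperHalfPlane.I = z := by
  have h := (Real.sqrt_pos.2 z.im_pos).ne'
  refine UpperHalfPlane.ext_re_im ?_ ?_
  · rw [re_smul_I]
    simp [triangular]
    field_simp
  · rw [im_smul_I]
    simp [triangular, Real.sq_sqrt z.im_pos.le]

/-- The components of a frame in the adapted frame at the same point. -/
theorem inv_frameMatrix_mul_mem {t : ℝ} (y : PulledFrames t) {A : SL(2, ℝ)}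
    (h : A • UpperHalfPlane.I = y.base) :
    (frameMatrix t (A 1 0) (A 1 1))⁻¹ * y.point.frame ∈ Matrix.specialOrthogonalGroup (Fin 3) ℝ := by
  have hd := det_frameMatrix_pos t A.sq_add_sq_pos
  have h1 := y.point.orthonormal
  have h2 := (adaptedFrame t A).orthonormal
  rw [y.base_eq, ← h] at h1
  change (frameMatrix t (A 1 0) (A 1 1))ᵀ * hypMetric (phi t (A • UpperHalfPlane.I)).1 *
    frameMatrix t (A 1 0) (A 1 1) = 1 at h2
  generalize frameMatrix t (A 1 0) (A 1 1) = F at *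
  have hF : F * F⁻¹ = 1 := Matrix.mul_nonsing_inv _ hd.ne'.isUnit
  have ho : (F⁻¹ * y.point.frame)ᵀ * (F⁻¹ * y.point.frame) = 1 := by
    calc _ = (F⁻¹ * y.point.frame)ᵀ * (Fᵀ * hypMetric (phi t (A • UpperHalfPlane.I)).1 * F) *
          (F⁻¹ * y.point.frame) := by rw [h2, mul_one]
      _ = (F * F⁻¹ * y.point.frame)ᵀ * hypMetric (phi t (A • UpperHalfPlane.I)).1 *
          (F * F⁻¹ * y.point.frame) := by
        simp only [Matrix.transpose_mul, mul_assoc]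
      _ = 1 := by rw [hF, one_mul, h1]
  refine Matrix.mem_specialOrthogonalGroup_iff.2
    ⟨(Matrix.mem_orthogonalGroup_iff' (Fin 3) ℝ).2 ho, ?_⟩
  have h3 : 0 < (F⁻¹ * y.point.frame).det := by
    rw [Matrix.det_mul, Matrix.det_nonsing_inv, Ring.inverse_eq_inv']
    exact mul_pos (inv_pos.2 hd) y.point.oriented
  -- The determinant squares to one and is positive.
  have h4 := congrArg Matrix.det ho
  rw [Matrix.det_mul, Matrix.det_transpose, Matrix.det_one] at h4
  nlinarith

theorem liftedFrame_eq_of_adMatrix {t : ℝ} {y : PulledFrames t} {A : SL(2, ℝ)} {U : SU2}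
    (h : A • UpperHalfPlane.I = y.base)
    (h' : adMatrix U = (frameMatrix t (A 1 0) (A 1 1))⁻¹ * y.point.frame) :
    liftedFrame t (A, U) = y := by
  refine PulledFrames.ext_frame h ?_
  rw [liftedFrame_frame, h', Matrix.mul_nonsing_inv_cancel_left]
  exact (det_frameMatrix_pos t A.sq_add_sq_pos).ne'.isUnit

theorem liftedFrame_surjective (t : ℝ) : Function.Surjective (liftedFrame t) := by
  intro y
  have h := triangular_smul_I y.base
  obtain ⟨U, hU⟩ := exists_adMatrix_eq (inv_frameMatrix_mul_mem y h)
  exact ⟨_, liftedFrame_eq_of_adMatrix h hU⟩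

/-- Both `P.quot` and `liftedFrame t` are surjective with the same fibres, so they identify their
targets. The arbitrary right inverse of `P.quot` is used only to name the map and disappears from
the characterising equation. -/
theorem exists_frameEquiv (t : ℝ) :
    ∃ Φ : P ≃ PulledFrames t, ∀ x, Φ (P.quot x) = liftedFrame t x := by
  have h : ∀ x, liftedFrame t (Function.surjInv P.quot_surjective (P.quot x)) =
      liftedFrame t x := fun x =>
    (liftedFrame_eq_iff t _ _).2 (Function.surjInv_eq P.quot_surjective (P.quot x))
  refine ⟨Equiv.ofBijective (fun y => liftedFrame t (Function.surjInv P.quot_surjective y))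
    ⟨fun y y' hy => ?_, fun z => ?_⟩, h⟩
  · obtain ⟨x, rfl⟩ := P.quot_surjective y
    obtain ⟨x', rfl⟩ := P.quot_surjective y'
    dsimp only at hy
    rwa [h, h, liftedFrame_eq_iff] at hy
  · obtain ⟨x, rfl⟩ := liftedFrame_surjective t z
    exact ⟨P.quot x, h x⟩

/-- The isomorphism `P_χ → φ_t^* SO(H³)`, `[A, U] ↦ F_A Ad(U)`. -/
def frameEquiv (t : ℝ) : P ≃ PulledFrames t := (exists_frameEquiv t).choose

theorem frameEquiv_quot (t : ℝ) (x : SL(2, ℝ) × SU2) :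
    frameEquiv t (P.quot x) = liftedFrame t x := (exists_frameEquiv t).choose_spec x

theorem frameEquiv_base (t : ℝ) (y : P) : (frameEquiv t y).base = y.proj := by
  obtain ⟨x, rfl⟩ := P.quot_surjective y
  rw [frameEquiv_quot]
  rfl

theorem frameEquiv_act (t : ℝ) (y : P) (k : PU2) :
    frameEquiv t (y.act k) = (frameEquiv t y).act (Ad k) := by
  obtain ⟨x, rfl⟩ := P.quot_surjective y
  induction k using QuotientGroup.induction_on with
  | H V =>
  have h : (P.quot x).act (QuotientGroup.mk V) = P.quot (x.1, x.2 * V) := rfl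
  rw [h, frameEquiv_quot, frameEquiv_quot]
  refine PulledFrames.ext_frame rfl ?_
  rw [liftedFrame_frame, adMatrix_mul, ← mul_assoc]
  rfl

/-! ### Smoothness -/

theorem SU2.star_eq_inv (U : SU2) : star (U : Matrix (Fin 2) (Fin 2) ℂ) =
    (U : Matrix (Fin 2) (Fin 2) ℂ)⁻¹ := (Matrix.inv_eq_right_inv (SU2.mul_star U)).symm

/-- On `SU(2)` the conjugate transpose is the inverse, so each entry is a linear functional of `U aⱼ
U⁻¹`. -/
theorem contDiff_adMatrix {n : ℕ} {U : E n → SU2}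
    (hU : ContDiff ℝ ∞ (fun y => (U y : Matrix (Fin 2) (Fin 2) ℂ))) :
    ContDiff ℝ ∞ (fun y => adMatrix (U y)) := by
  refine contDiff_matrix_iff.2 fun i j => ?_
  have h : ContDiff ℝ ∞ (fun y => (U y : Matrix (Fin 2) (Fin 2) ℂ) * aBasis j *
      (U y : Matrix (Fin 2) (Fin 2) ℂ)⁻¹) :=
    (hU.mul contDiff_const).mul (contDiff_inv_complex hU fun y => SU2.isUnit _)
  simp only [← SU2.star_eq_inv] at h
  exact (LinearMap.toContinuousLinearMap (coord i)).contDiff.comp h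

theorem contDiff_rotationMatrix {n : ℕ} {c d : E n → ℝ} (hc : ContDiff ℝ ∞ c)
    (hd : ContDiff ℝ ∞ d) : ContDiff ℝ ∞ (fun y => rotationMatrix (c y) (d y)) := by
  refine contDiff_matrix_iff.2 fun i j => ?_
  fin_cases i <;> fin_cases j <;> simp [rotationMatrix] <;> fun_prop

theorem contDiff_frameMatrix (t : ℝ) {n : ℕ} {c d : E n → ℝ} (hc : ContDiff ℝ ∞ c)
    (hd : ContDiff ℝ ∞ d) (h : ∀ y, 0 < c y ^ 2 + d y ^ 2) :
    ContDiff ℝ ∞ (fun y => frameMatrix t (c y) (d y)) := by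
  have h1 : ContDiff ℝ ∞ (fun y => (Real.cosh t * (c y ^ 2 + d y ^ 2) ^ 2)⁻¹) :=
    (contDiff_const.mul (((hc.pow 2).add (hd.pow 2)).pow 2)).inv fun y =>
      (mul_pos (Real.cosh_pos t) (pow_pos (h y) 2)).ne'
  exact h1.smul (contDiff_const.mul (contDiff_rotationMatrix hc hd))

theorem contDiff_phi (t : ℝ) {n : ℕ} {z : E n → UpperHalfPlane}
    (hz : ContDiff ℝ ∞ (fun y => (z y : ℂ))) :
    ContDiff ℝ ∞ (fun y => ((phi t (z y) : H3) : E 3)) := by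
  have hre : ContDiff ℝ ∞ (fun y => (z y).re) := Complex.reCLM.contDiff.comp hz
  have him : ContDiff ℝ ∞ (fun y => (z y).im) := Complex.imCLM.contDiff.comp hz
  simp only [phi_coe]
  refine contDiff_euclidean.2 fun i => ?_
  fin_cases i
  · exact him.mul contDiff_const
  · exact hre
  · exact him.div_const _

theorem dSmooth_liftedFrame (t : ℝ) : DSmooth (liftedFrame t) := by
  intro n p hp
  have hA := contDiff_matrix_iff.1 (contDiff_fst_of_isPlot hp)
  have hN : ∀ y, (p y).1 1 0 ^ 2 + (p y).1 1 1 ^ 2 ≠ 0 := fun y =>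
    ((p y).1.sq_add_sq_pos).ne'
  have cN := ((hA 1 0).pow 2).add ((hA 1 1).pow 2)
  have hz : ContDiff ℝ ∞ (fun y => (((p y).1 • UpperHalfPlane.I : UpperHalfPlane) : ℂ)) := by
    simp only [coe_smul_I]
    refine ContDiff.add (Complex.ofRealCLM.contDiff.comp ?_)
      (ContDiff.mul (Complex.ofRealCLM.contDiff.comp ?_) contDiff_const)
    · exact (((hA 0 0).mul (hA 1 0)).add ((hA 0 1).mul (hA 1 1))).div cN hN
    · exact cN.inv hN
  refine PulledFrames.isPlot_iff.2 (hz.prodMk ((contDiff_phi t hz).prodMk ?_))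
  exact (contDiff_frameMatrix t (hA 1 0) (hA 1 1) fun y => (p y).1.sq_add_sq_pos).mul
    (contDiff_adMatrix (contDiff_snd_of_isPlot hp))

/-- A plot of `P` lifts locally to `SL(2, ℝ) × SU(2)`, and on a lift the map is `liftedFrame`. -/
theorem dSmooth_frameEquiv (t : ℝ) : DSmooth (frameEquiv t) := by
  intro n p hp
  refine PulledFrames.isPlot_iff.2 (contDiff_iff_contDiffAt.2 fun x => ?_)
  obtain ⟨p', hp', h⟩ := hp x
  refine (PulledFrames.isPlot_iff.1 (dSmooth_liftedFrame t n p' hp')).contDiffAt.congr_of_eventuallyEq ?_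
  filter_upwards [h] with y hy
  rw [Function.comp_apply, Function.comp_apply, ← hy, frameEquiv_quot]

theorem contDiff_triangular {n : ℕ} {z : E n → UpperHalfPlane}
    (hz : ContDiff ℝ ∞ (fun y => (z y : ℂ))) :
    ContDiff ℝ ∞ (fun y => (triangular (z y) : Matrix (Fin 2) (Fin 2) ℝ)) := by
  have hre : ContDiff ℝ ∞ (fun y => (z y).re) := Complex.reCLM.contDiff.comp hz
  have him : ContDiff ℝ ∞ (fun y => √(z y).im) :=
    ContDiff.sqrt (Complex.imCLM.contDiff.comp hz) fun y => (z y).im_pos.ne'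
  have h0 : ∀ y, √(z y).im ≠ 0 := fun y => (Real.sqrt_pos.2 (z y).im_pos).ne'
  refine contDiff_matrix_iff.2 fun i j => ?_
  fin_cases i <;> fin_cases j
  · exact him
  · exact hre.div him h0
  · exact contDiff_const
  · exact him.inv h0

/-- A local lift is built from two sections: `triangular` over the base, and a smooth local lift to
`SU(2)` of the rotation that expresses the given frame in the adapted one. -/
theorem dSmooth_frameEquiv_symm (t : ℝ) : DSmooth (frameEquiv t).symm := by
  intro n p hp x
  have hz : ContDiff ℝ ∞ (fun y => ((p y).base : ℂ)) := (PulledFrames.isPlot_iff.1 hp).fst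
  have hF : ContDiff ℝ ∞ (fun y => (p y).point.frame) := (PulledFrames.isPlot_iff.1 hp).snd.snd
  have hA := contDiff_triangular hz
  have hA' := contDiff_matrix_iff.1 hA
  have hf := contDiff_frameMatrix t (hA' 1 0) (hA' 1 1) fun y => SpecialLinearGroup.sq_add_sq_pos _
  have hf' := (contDiff_inv_real hf fun y => (Matrix.isUnit_iff_isUnit_det _).2
    (det_frameMatrix_pos t (SpecialLinearGroup.sq_add_sq_pos _)).ne'.isUnit).mul hF
  obtain ⟨U, hU, hUx⟩ := exists_contDiff_lift_adMatrix hf'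
    (fun y => inv_frameMatrix_mul_mem (p y) (triangular_smul_I _)) x
  refine ⟨fun y => (triangular (p y).base, U y), isPlot_up_iff.2 (hA.prodMk hU), ?_⟩
  filter_upwards [hUx] with y hy
  rw [Function.comp_apply, Equiv.eq_symm_apply, frameEquiv_quot]
  exact liftedFrame_eq_of_adMatrix (triangular_smul_I _) hy

/-! ### The Levi-Civita connection of hyperbolic space -/

theorem partialDeriv_hypMetric (i j k : Fin 3) {x : E 3} (hx : 0 < x 2) :
    partialDeriv hypMetric i j k x =
      if i = 2 ∧ j = k then -2 / x 2 ^ 3 else 0 := by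
  have h1 : HasFDerivAt (fun y : E 3 => y 2)
      (EuclideanSpace.proj (𝕜 := ℝ) (2 : Fin 3) : E 3 →L[ℝ] ℝ) x :=
    (EuclideanSpace.proj (𝕜 := ℝ) (2 : Fin 3)).hasFDerivAt
  have h2 : HasFDerivAt (fun y : E 3 => hypMetric y j k) _ x :=
    ((hasDerivAt_inv (pow_pos hx 2).ne').comp_hasFDerivAt x (h1.pow 2)).mul_const
      ((1 : Matrix (Fin 3) (Fin 3) ℝ) j k)
  rw [partialDeriv, h2.fderiv]
  have hx' := hx.ne'
  by_cases hjk : j = k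
  · subst hjk
    fin_cases i <;> simp
    field_simp
  · fin_cases i <;> simp [hjk]

theorem inv_hypMetric {x : E 3} (hx : 0 < x 2) :
    (hypMetric x)⁻¹ = (x 2 ^ 2) • (1 : Matrix (Fin 3) (Fin 3) ℝ) := by
  refine Matrix.inv_eq_left_inv ?_
  rw [hypMetric, smul_mul_smul_comm, mul_one, mul_inv_cancel₀ (pow_pos hx 2).ne', one_smul]

/-- The connection matrix of the Levi-Civita connection of `H³` in the coordinate frame. -/
theorem christoffelForm_hypMetric {x : E 3} (hx : 0 < x 2) (u : E 3) :
    christoffelForm hypMetric x u = (-(x 2)⁻¹) •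
      !![u 2, 0, u 0; 0, u 2, u 1; -u 0, -u 1, u 2] := by
  have hx' := hx.ne'
  ext k j
  have h : christoffelForm hypMetric x u k j = ∑ i, u i * christoffel hypMetric i j k x := by
    simp [christoffelForm, Matrix.sum_apply]
  rw [h]
  simp only [christoffel, partialDeriv_hypMetric _ _ _ hx, inv_hypMetric hx]
  fin_cases k <;> fin_cases j <;> simp [Fin.sum_univ_three] <;> field_simp

/-! ### The adjoint representation and its differential -/

/-- This turns a product of coordinate matrices into the composite of the operators they represent;
it is valid only when the intermediate vector `Z` lies in `su(2)`. -/
theorem sum_coord_mul_coord {Z : Matrix (Fin 2) (Fin 2) ℂ} (h : star Z = -Z) (h' : Z.trace = 0)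
    (L : Matrix (Fin 2) (Fin 2) ℂ →ₗ[ℝ] ℝ) : ∑ k, L (aBasis k) * coord k Z = L Z := by
  conv_rhs => rw [← sum_coord h h', map_sum]
  exact Finset.sum_congr rfl fun k _ => by rw [map_smul, smul_eq_mul, mul_comm]

theorem adStar_apply (X : Matrix (Fin 2) (Fin 2) ℂ) (i j : Fin 3) :
    adStar X i j = coord i (X * aBasis j - aBasis j * X) := rfl

theorem star_commutator_aBasis {X : Matrix (Fin 2) (Fin 2) ℂ} (h : star X = -X) (j : Fin 3) :
    star (X * aBasis j - aBasis j * X) = -(X * aBasis j - aBasis j * X) := by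
  rw [star_sub, star_mul, star_mul, h, star_aBasis]
  noncomm_ring

theorem trace_commutator (X Y : Matrix (Fin 2) (Fin 2) ℂ) : (X * Y - Y * X).trace = 0 := by
  rw [Matrix.trace_sub, Matrix.trace_mul_comm, sub_self]

/-- Skewness of `Y` suffices for `[Y, aⱼ]` to lie in `su(2)`, since commutators have trace zero in
any case. -/
theorem adMatrix_mul_adStar (U : SU2) {Y : Matrix (Fin 2) (Fin 2) ℂ} (h : star Y = -Y)
    (i j : Fin 3) : (adMatrix U * adStar Y) i j =
      coord i (U * (Y * aBasis j - aBasis j * Y) * star (U : Matrix (Fin 2) (Fin 2) ℂ)) := by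
  have h1 := sum_coord_mul_coord (star_commutator_aBasis h j) (trace_commutator Y (aBasis j))
    ((coord i).comp (LinearMap.mulLeftRight ℝ
      ((U : Matrix (Fin 2) (Fin 2) ℂ), star (U : Matrix (Fin 2) (Fin 2) ℂ))))
  rw [Matrix.mul_apply]
  exact h1

theorem adStar_mul_adMatrix (U : SU2) (Z : Matrix (Fin 2) (Fin 2) ℂ) (i j : Fin 3) :
    (adStar Z * adMatrix U) i j =
      coord i (Z * (U * aBasis j * star (U : Matrix (Fin 2) (Fin 2) ℂ)) -
        (U * aBasis j * star (U : Matrix (Fin 2) (Fin 2) ℂ)) * Z) := by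
  have h1 := sum_coord_mul_coord (Z := U * aBasis j * star (U : Matrix (Fin 2) (Fin 2) ℂ))
    (by simp [star_aBasis, mul_assoc])
    (by rw [Matrix.trace_mul_comm, ← mul_assoc, SU2.star_mul, one_mul, trace_aBasis])
    ((coord i).comp (LinearMap.mulLeft ℝ Z - LinearMap.mulRight ℝ Z))
  rw [Matrix.mul_apply]
  exact h1

/-- Conjugation by `U` is an automorphism, so it carries the bracket with `U⁻¹ZU` to the bracket
with `Z`. -/
theorem adMatrix_mul_adStar_conj (U : SU2) {Z : Matrix (Fin 2) (Fin 2) ℂ} (h : star Z = -Z) :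
    adMatrix U * adStar ((U : Matrix (Fin 2) (Fin 2) ℂ)⁻¹ * Z * (U : Matrix (Fin 2) (Fin 2) ℂ)) =
      adStar Z * adMatrix U := by
  ext i j
  rw [← SU2.star_eq_inv, adMatrix_mul_adStar _ (by simp [h, mul_assoc]), adStar_mul_adMatrix]
  congr 1
  have h1 := SU2.mul_star U
  generalize (U : Matrix (Fin 2) (Fin 2) ℂ) = V at *
  calc _ = (V * star V) * Z * (V * aBasis j * star V) -
        (V * aBasis j * star V) * Z * (V * star V) := by noncomm_ring
    _ = _ := by rw [h1, one_mul, mul_one]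

/-- Differentiation of `U* U = 1` gives the skewness; the second part says that differentiation
commutes with the real linear map `star`. -/
theorem star_inv_mul_fderiv {n : ℕ} {U : E n → SU2}
    (hU : ContDiff ℝ ∞ (fun y => (U y : Matrix (Fin 2) (Fin 2) ℂ))) (x v : E n) :
    star ((U x : Matrix (Fin 2) (Fin 2) ℂ)⁻¹ *
        fderiv ℝ (fun y => (U y : Matrix (Fin 2) (Fin 2) ℂ)) x v) =
      -((U x : Matrix (Fin 2) (Fin 2) ℂ)⁻¹ *
        fderiv ℝ (fun y => (U y : Matrix (Fin 2) (Fin 2) ℂ)) x v) ∧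
    fderiv ℝ (fun y => star (U y : Matrix (Fin 2) (Fin 2) ℂ)) x v =
      star (fderiv ℝ (fun y => (U y : Matrix (Fin 2) (Fin 2) ℂ)) x v) := by
  have dU := (hU.differentiable (by simp) x).hasFDerivAt
  have dS : HasFDerivAt (fun y => star (U y : Matrix (Fin 2) (Fin 2) ℂ)) _ x := dU.star
  have h1 := (dS.mul' dU)
  have h2 : HasFDerivAt (fun _ => (1 : Matrix (Fin 2) (Fin 2) ℂ)) _ x :=
    h1.congr_of_eventuallyEq (Filter.Eventually.of_forall fun y => (SU2.star_mul (U y)).symm)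
  have h3 := congrArg (fun L => L v) ((hasFDerivAt_const _ x).unique h2)
  refine ⟨?_, congrArg (fun L => L v) dS.fderiv⟩
  have h4 : (0 : Matrix (Fin 2) (Fin 2) ℂ) =
    star (U x : Matrix (Fin 2) (Fin 2) ℂ) *
        fderiv ℝ (fun y => (U y : Matrix (Fin 2) (Fin 2) ℂ)) x v +
      star (fderiv ℝ (fun y => (U y : Matrix (Fin 2) (Fin 2) ℂ)) x v) * U x := h3
  rw [← SU2.star_eq_inv, star_mul, star_star]
  exact eq_neg_of_add_eq_zero_right h4.symm

theorem fderiv_adMatrix {n : ℕ} {U : E n → SU2}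
    (hU : ContDiff ℝ ∞ (fun y => (U y : Matrix (Fin 2) (Fin 2) ℂ))) (x v : E n) :
    fderiv ℝ (fun y => adMatrix (U y)) x v = adMatrix (U x) *
      adStar ((U x : Matrix (Fin 2) (Fin 2) ℂ)⁻¹ *
        fderiv ℝ (fun y => (U y : Matrix (Fin 2) (Fin 2) ℂ)) x v) := by
  obtain ⟨hskew, hstar⟩ := star_inv_mul_fderiv hU x v
  have dU := (hU.differentiable (by simp) x).hasFDerivAt
  have dS : HasFDerivAt (fun y => star (U y : Matrix (Fin 2) (Fin 2) ℂ))
    (fderiv ℝ (fun y => star (U y : Matrix (Fin 2) (Fin 2) ℂ)) x) x :=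
      dU.star.differentiableAt.hasFDerivAt
  have dM := ((contDiff_adMatrix hU).differentiable (by simp) x).hasFDerivAt
  ext i j
  rw [adMatrix_mul_adStar _ hskew]
  have h1 : HasFDerivAt (fun y => adMatrix (U y) i j) _ x :=
    (LinearMap.toContinuousLinearMap (Matrix.entryLinearMap ℝ ℝ i j)).hasFDerivAt.comp x dM
  have h2 : HasFDerivAt (fun y => adMatrix (U y) i j) _ x :=
    (LinearMap.toContinuousLinearMap (coord i)).hasFDerivAt.comp x
      ((dU.mul' (hasFDerivAt_const (aBasis j) x)).mul' dS)
  refine (congrArg (fun L => L v) (h1.unique h2)).trans ?_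
  set D := fderiv ℝ (fun y => (U y : Matrix (Fin 2) (Fin 2) ℂ)) x v
  change coord i ((U x : Matrix (Fin 2) (Fin 2) ℂ) * aBasis j *
      fderiv ℝ (fun y => star (U y : Matrix (Fin 2) (Fin 2) ℂ)) x v +
    (U x * (0 : Matrix (Fin 2) (Fin 2) ℂ) + D * aBasis j) * star (U x : Matrix (Fin 2) (Fin 2) ℂ)) = _
  rw [hstar]
  congr 1
  -- With `D = UY` and `Y* = -Y`, the product rule for `U aⱼ U*` collapses to `U [Y, aⱼ] U*`.
  have hD : D = U x * ((U x : Matrix (Fin 2) (Fin 2) ℂ)⁻¹ * D) := by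
    rw [← SU2.star_eq_inv, ← mul_assoc, SU2.mul_star, one_mul]
  generalize (U x : Matrix (Fin 2) (Fin 2) ℂ)⁻¹ * D = Y at *
  rw [hD, star_mul, hskew]
  noncomm_ring

/-- The upper left block is the connection of the surface, from the `b₃`-component of `X`; the last
row and column are its second fundamental form, proportional to `s`. -/
theorem adStar_lam (s : ℝ) (X : Matrix (Fin 2) (Fin 2) ℝ) : adStar (lam s X) =
    !![0, -(X 0 1 - X 1 0), s * (X 0 1 + X 1 0);
      X 0 1 - X 1 0, 0, s * (X 0 0 - X 1 1);
      -(s * (X 0 1 + X 1 0)), -(s * (X 0 0 - X 1 1)), 0] := by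
  ext i j
  rw [adStar_apply, lam_apply]
  fin_cases i <;> fin_cases j <;>
    simp [coord, aBasis, Matrix.trace_fin_two] <;> ring

theorem star_lam (s : ℝ) (X : Matrix (Fin 2) (Fin 2) ℝ) : star (lam s X) = -lam s X := by
  rw [lam_apply]
  simp only [star_add, star_sub, star_smul, star_aBasis, star_trivial]
  module

/-! ### The connection forms -/

/-- The derivative of `rotationMatrix` at `(c, d)` in the direction `(c', d')`. -/
def rotationDeriv (c d c' d' : ℝ) : Matrix (Fin 3) (Fin 3) ℝ :=
  !![-2 * (c' * d + c * d'), 2 * (d * d' - c * c'), 0;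
    2 * (d * d' - c * c'), 2 * (c' * d + c * d'), 0; 0, 0, 2 * (c * c' + d * d')]

/-- The second term comes from the scalar factor: the logarithmic derivative of `(c² + d²)⁻²` is
`-4(cc' + dd') / (c² + d²)`. -/
theorem fderiv_frameMatrix (t : ℝ) {n : ℕ} {c d : E n → ℝ} {x : E n} {c' d' : E n →L[ℝ] ℝ}
    (hc : HasFDerivAt c c' x) (hd : HasFDerivAt d d' x) (h : 0 < c x ^ 2 + d x ^ 2) (v : E n) :
    fderiv ℝ (fun y => frameMatrix t (c y) (d y)) x v =
      (Real.cosh t * (c x ^ 2 + d x ^ 2) ^ 2)⁻¹ • (surfaceMatrix t *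
        (rotationDeriv (c x) (d x) (c' v) (d' v) -
          (4 * (c x * c' v + d x * d' v) / (c x ^ 2 + d x ^ 2)) • rotationMatrix (c x) (d x))) := by
  have hch := (Real.cosh_pos t).ne'
  -- `rotationMatrix` is quadratic in `(c, d)`; these are the constant coefficients of `c²`, `cd`,
  -- `d²`, which reduces its derivative to the scalar product rule.
  let E₁ : Matrix (Fin 3) (Fin 3) ℝ := !![0, -1, 0; -1, 0, 0; 0, 0, 1]
  let E₂ : Matrix (Fin 3) (Fin 3) ℝ := !![-2, 0, 0; 0, 2, 0; 0, 0, 0]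
  let E₃ : Matrix (Fin 3) (Fin 3) ℝ := !![0, 1, 0; 1, 0, 0; 0, 0, 1]
  have hrot : ∀ a b : ℝ, rotationMatrix a b = (a * a) • E₁ + (a * b) • E₂ + (b * b) • E₃ := by
    intro a b
    ext i j
    fin_cases i <;> fin_cases j <;> simp [rotationMatrix, E₁, E₂, E₃] <;> ring
  have dR := (((hc.mul hc).smul_const E₁).add ((hc.mul hd).smul_const E₂)).add
    ((hd.mul hd).smul_const E₃)
  replace dR : HasFDerivAt (fun y => rotationMatrix (c y) (d y)) _ x :=
    dR.congr_of_eventuallyEq (Filter.Eventually.of_forall fun y => hrot (c y) (d y))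
  have dk : HasFDerivAt (fun y => (Real.cosh t * (c y ^ 2 + d y ^ 2) ^ 2)⁻¹) _ x :=
    (hasDerivAt_inv (mul_pos (Real.cosh_pos t) (pow_pos h 2)).ne').comp_hasFDerivAt x
      ((((hc.pow 2).add (hd.pow 2)).pow 2).const_mul (Real.cosh t))
  have dF : HasFDerivAt (fun y => frameMatrix t (c y) (d y)) _ x :=
    dk.smul ((hasFDerivAt_const (surfaceMatrix t) x).mul' dR)
  rw [dF.fderiv]
  have h0 := h.ne'
  have e1 : rotationDeriv (c x) (d x) (c' v) (d' v) =
      (c x * c' v + c x * c' v) • E₁ + (c x * d' v + d x * c' v) • E₂ +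
        (d x * d' v + d x * d' v) • E₃ := by
    ext i j
    fin_cases i <;> fin_cases j <;> simp [rotationDeriv, E₁, E₂, E₃] <;> ring
  change (Real.cosh t * (c x ^ 2 + d x ^ 2) ^ 2)⁻¹ • (surfaceMatrix t *
      ((c x * c' v + c x * c' v) • E₁ + (c x * d' v + d x * c' v) • E₂ +
        (d x * d' v + d x * d' v) • E₃) + 0 * rotationMatrix (c x) (d x)) +
    (-((Real.cosh t * (c x ^ 2 + d x ^ 2) ^ 2) ^ 2)⁻¹ * (Real.cosh t *
      ((2 • (c x ^ 2 + d x ^ 2) ^ (2 - 1)) * ((2 • c x ^ (2 - 1)) * c' v +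
        (2 • d x ^ (2 - 1)) * d' v)))) • (surfaceMatrix t * rotationMatrix (c x) (d x)) = _
  rw [zero_mul, add_zero, mul_sub, mul_smul_comm, smul_sub, smul_smul, sub_eq_add_neg, ← neg_smul,
    e1]
  congr 2
  simp
  field_simp
  ring

theorem fderiv_phi_smul_I (t : ℝ) {n : ℕ} {A : E n → SL(2, ℝ)}
    (hA : ContDiff ℝ ∞ (fun y => (A y : Matrix (Fin 2) (Fin 2) ℝ))) {x v : E n} {a b c d a' b' c' d' : ℝ}
    (hAx : (A x : Matrix (Fin 2) (Fin 2) ℝ) = !![a, b; c, d])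
    (hA'x : fderiv ℝ (fun y => (A y : Matrix (Fin 2) (Fin 2) ℝ)) x v = !![a', b'; c', d']) :
    fderiv ℝ (fun y => ((phi t (A y • UpperHalfPlane.I) : H3) : E 3)) x v =
      !₂[-(2 * (c * c' + d * d') / (c ^ 2 + d ^ 2) ^ 2) * Real.tanh t,
        ((a' * c + a * c' + b' * d + b * d') * (c ^ 2 + d ^ 2) -
          (a * c + b * d) * (2 * (c * c' + d * d'))) / (c ^ 2 + d ^ 2) ^ 2,
        -(2 * (c * c' + d * d') / (c ^ 2 + d ^ 2) ^ 2) / Real.cosh t] := by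
  have dA := (hA.differentiable (by simp) x).hasFDerivAt
  have ent : ∀ i j, HasFDerivAt (fun y => A y i j) ((LinearMap.toContinuousLinearMap
      (Matrix.entryLinearMap ℝ ℝ i j)).comp
        (fderiv ℝ (fun y => (A y : Matrix (Fin 2) (Fin 2) ℝ)) x)) x := fun i j =>
    (LinearMap.toContinuousLinearMap (Matrix.entryLinearMap ℝ ℝ i j)).hasFDerivAt.comp x dA
  have hN := (A x).sq_add_sq_pos.ne'
  -- The smoothness of `A • i` is read off from the base component of `liftedFrame`; the parameter
  -- `0` and the trivial `SU(2)` component play no role.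
  have hz : ContDiff ℝ ∞ (fun y => ((A y • UpperHalfPlane.I : UpperHalfPlane) : ℂ)) := by
    have := dSmooth_liftedFrame 0 n (fun y => (A y, 1))
      (isPlot_up_iff.2 (hA.prodMk contDiff_const))
    exact (PulledFrames.isPlot_iff.1 this).fst
  have dphi := ((contDiff_phi t hz).differentiable (by simp) x).hasFDerivAt
  have dN := ((ent 1 0).pow 2).add ((ent 1 1).pow 2)
  have dY : HasFDerivAt (fun y => (A y 1 0 ^ 2 + A y 1 1 ^ 2)⁻¹) _ x :=
    (hasDerivAt_inv hN).comp_hasFDerivAt x dN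
  have dX : HasFDerivAt (fun y => (A y 0 0 * A y 1 0 + A y 0 1 * A y 1 1) *
      (A y 1 0 ^ 2 + A y 1 1 ^ 2)⁻¹) _ x :=
    (((ent 0 0).mul (ent 1 0)).add ((ent 0 1).mul (ent 1 1))).mul dY
  have comp : ∀ i, HasFDerivAt (fun y => ((phi t (A y • UpperHalfPlane.I) : H3) : E 3) i) _ x :=
    fun i => (EuclideanSpace.proj (𝕜 := ℝ) i).hasFDerivAt.comp x dphi
  simp only [phi_coe, re_smul_I, im_smul_I, div_eq_mul_inv] at comp
  have h0 := congrArg (fun L => L v) ((comp 0).unique (dY.mul_const (Real.tanh t)))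
  have h1 := congrArg (fun L => L v) ((comp 1).unique dX)
  have h2 := congrArg (fun L => L v) ((comp 2).unique (dY.mul_const (Real.cosh t)⁻¹))
  simp only [phi_coe, re_smul_I, im_smul_I, div_eq_mul_inv]
  have hch := (Real.cosh_pos t).ne'
  simp [hAx, hA'x] at h0 h1 h2 hN
  ext i
  fin_cases i
  · refine h0.trans ?_
    simp
    field_simp
    ring
  · refine h1.trans ?_
    simp
    field_simp
    ring
  · refine h2.trans ?_
    simp
    field_simp
    ring

/-- The vector is the image of `X + iY` under the differential of `φ_t`, and the matrix on the right
is the Christoffel form in the basis `surfaceMatrix`. The multiples of `sinh t` are the second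
fundamental form; the diagonal is the conformal part, removed later by the derivative of the
normalising factor of the frame. -/
theorem christoffelForm_mul_surfaceMatrix (t : ℝ) {x : E 3} {N X Y : ℝ} (hN : 0 < N)
    (hx : x 2 = N⁻¹ / Real.cosh t) :
    christoffelForm hypMetric x !₂[Y * Real.tanh t, X, Y / Real.cosh t] * surfaceMatrix t =
      surfaceMatrix t * ((-N) • !![Y, -X, -(Real.sinh t * Y); X, Y, -(Real.sinh t * X);
        Real.sinh t * Y, Real.sinh t * X, Y]) := by
  have hc := Real.cosh_pos t
  have hc' := hc.ne'
  have hN' := hN.ne'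
  have h := Real.cosh_sq t
  rw [christoffelForm_hypMetric (by rw [hx]; positivity), hx, surfaceMatrix,
    Real.tanh_eq_sinh_div_cosh]
  ext i j
  fin_cases i <;> fin_cases j <;>
    simp [Matrix.mul_apply, Fin.sum_univ_three] <;> field_simp <;>
    first
      | ring1
      | linear_combination Y * h
      | linear_combination (-Y) * h
      | linear_combination X * h

/-- The algebraic identity behind the equality of the two connections along adapted frames. -/
theorem rotationDeriv_add_eq (s c d p q r : ℝ) (hN : 0 < c ^ 2 + d ^ 2) {X Y : ℝ}
    (hX : X = ((d ^ 2 - c ^ 2) * (q + r) + 4 * c * d * p) / (c ^ 2 + d ^ 2) ^ 2)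
    (hY : Y = (-2 * c * d * (q + r) + 2 * (d ^ 2 - c ^ 2) * p) / (c ^ 2 + d ^ 2) ^ 2) :
    rotationDeriv c d (c * p + d * r) (c * q - d * p) -
          (4 * (c * (c * p + d * r) + d * (c * q - d * p)) / (c ^ 2 + d ^ 2)) • rotationMatrix c d +
        ((-(c ^ 2 + d ^ 2)) • !![Y, -X, -(s * Y); X, Y, -(s * X); s * Y, s * X, Y]) *
          rotationMatrix c d =
      rotationMatrix c d * !![0, -(q - r), s * (q + r); q - r, 0, s * (2 * p);
        -(s * (q + r)), -(s * (2 * p)), 0] := by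
  have hN' := hN.ne'
  subst hX hY
  ext i j
  fin_cases i <;> fin_cases j <;>
    simp [rotationDeriv, rotationMatrix, Matrix.mul_apply, Fin.sum_univ_three] <;>
    field_simp <;> ring

/-- Along adapted frames, the Levi-Civita connection is the invariant connection. -/
theorem fderiv_frameMatrix_add (t : ℝ) {n : ℕ} {A : E n → SL(2, ℝ)}
    (hA : ContDiff ℝ ∞ (fun y => (A y : Matrix (Fin 2) (Fin 2) ℝ))) (x v : E n) :
    fderiv ℝ (fun y => frameMatrix t (A y 1 0) (A y 1 1)) x v +
        christoffelForm hypMetric ((phi t (A x • UpperHalfPlane.I) : H3) : E 3)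
            (fderiv ℝ (fun y => ((phi t (A y • UpperHalfPlane.I) : H3) : E 3)) x v) *
          frameMatrix t (A x 1 0) (A x 1 1) =
      frameMatrix t (A x 1 0) (A x 1 1) * adStar (lam (Real.sinh t)
        ((A x : Matrix (Fin 2) (Fin 2) ℝ)⁻¹ *
          fderiv ℝ (fun y => (A y : Matrix (Fin 2) (Fin 2) ℝ)) x v)) := by
  have dA := (hA.differentiable (by simp) x).hasFDerivAt
  have ent : ∀ i j, HasFDerivAt (fun y => A y i j) ((LinearMap.toContinuousLinearMap
      (Matrix.entryLinearMap ℝ ℝ i j)).comp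
        (fderiv ℝ (fun y => (A y : Matrix (Fin 2) (Fin 2) ℝ)) x)) x := fun i j =>
    (LinearMap.toContinuousLinearMap (Matrix.entryLinearMap ℝ ℝ i j)).hasFDerivAt.comp x dA
  have hN := (A x).sq_add_sq_pos
  have hdet := (A x).det_coe
  have hinv := Matrix.mul_nonsing_inv_cancel_left (A x : Matrix (Fin 2) (Fin 2) ℝ)
    (fderiv ℝ (fun y => (A y : Matrix (Fin 2) (Fin 2) ℝ)) x v) (by rw [hdet]; exact isUnit_one)
  have hb := fun {X Y : ℝ} => christoffelForm_mul_surfaceMatrix t (X := X) (Y := Y) hN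
    (x := ((phi t (A x • UpperHalfPlane.I) : H3) : E 3)) (by rw [phi_coe, im_smul_I]; rfl)
  have dF := fderiv_frameMatrix t (ent 1 0) (ent 1 1) hN v
  have dφ := fun {a b c d a' b' c' d' : ℝ} =>
    fderiv_phi_smul_I t hA (x := x) (v := v) (a := a) (b := b) (c := c) (d := d) (a' := a')
      (b' := b') (c' := c') (d' := d')
  simp only [ContinuousLinearMap.comp_apply, LinearMap.coe_toContinuousLinearMap',
    Matrix.entryLinearMap_apply] at dF
  -- the trace of `A⁻¹ dA` vanishes
  have htr : A x 0 0 * fderiv ℝ (fun y => (A y : Matrix (Fin 2) (Fin 2) ℝ)) x v 1 1 +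
      A x 1 1 * fderiv ℝ (fun y => (A y : Matrix (Fin 2) (Fin 2) ℝ)) x v 0 0 -
      (A x 0 1 * fderiv ℝ (fun y => (A y : Matrix (Fin 2) (Fin 2) ℝ)) x v 1 0 +
      A x 1 0 * fderiv ℝ (fun y => (A y : Matrix (Fin 2) (Fin 2) ℝ)) x v 0 1) = 0 := by
    have h1 := ((ent 0 0).mul (ent 1 1)).sub ((ent 0 1).mul (ent 1 0))
    have h2 : HasFDerivAt (fun _ => (1 : ℝ)) _ x :=
      h1.congr_of_eventuallyEq (Filter.Eventually.of_forall fun y => by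
        have := (A y).det_coe
        rw [Matrix.det_fin_two] at this
        exact this.symm)
    exact (congrArg (fun L => L v) ((hasFDerivAt_const (1 : ℝ) x).unique h2)).symm
  rw [dF]
  clear dF ent dA
  -- From here on everything is algebra in the value `B` of `A` and in `Z = B⁻¹ dA`.
  generalize ((phi t (A x • UpperHalfPlane.I) : H3) : E 3) = z at *
  generalize fderiv ℝ (fun y => ((phi t (A y • UpperHalfPlane.I) : H3) : E 3)) x v = w at *
  generalize fderiv ℝ (fun y => (A y : Matrix (Fin 2) (Fin 2) ℝ)) x v = D at *
  generalize (A x : Matrix (Fin 2) (Fin 2) ℝ) = B at *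
  obtain ⟨Z, hZ⟩ : ∃ Z, Z = B⁻¹ * D := ⟨_, rfl⟩
  rw [← hZ] at hinv ⊢
  subst hinv
  rw [Matrix.det_fin_two] at hdet
  simp only [Matrix.mul_apply, Fin.sum_univ_two] at htr
  -- After substitution of `BZ` for the derivative, `htr` reads `det B · tr Z = 0`.
  have hZ1 : Z 1 1 = -Z 0 0 := by linear_combination htr - (Z 0 0 + Z 1 1) * hdet
  have hw := dφ (Matrix.eta_fin_two B) (Matrix.eta_fin_two (B * Z))
  simp only [Matrix.mul_apply, Fin.sum_univ_two, hZ1] at hw ⊢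
  -- `X + iY` is the velocity of `A • i`. The vector field of `Z` at `i` is `(Z₀₁ + Z₁₀) + 2 Z₀₀ i`,
  -- and the derivative of `B` multiplies it by `1 / (ci + d)² = (d - ic)² / (c² + d²)²`.
  obtain ⟨X, hX⟩ : ∃ X, X = ((B 1 1 ^ 2 - B 1 0 ^ 2) * (Z 0 1 + Z 1 0) +
    4 * B 1 0 * B 1 1 * Z 0 0) / (B 1 0 ^ 2 + B 1 1 ^ 2) ^ 2 := ⟨_, rfl⟩
  obtain ⟨Y, hY⟩ : ∃ Y, Y = (-2 * B 1 0 * B 1 1 * (Z 0 1 + Z 1 0) +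
    2 * (B 1 1 ^ 2 - B 1 0 ^ 2) * Z 0 0) / (B 1 0 ^ 2 + B 1 1 ^ 2) ^ 2 := ⟨_, rfl⟩
  have hw' : w = !₂[Y * Real.tanh t, X, Y / Real.cosh t] := by
    have eY : -(2 * (B 1 0 * (B 1 0 * Z 0 0 + B 1 1 * Z 1 0) +
        B 1 1 * (B 1 0 * Z 0 1 + B 1 1 * -Z 0 0)) / (B 1 0 ^ 2 + B 1 1 ^ 2) ^ 2) = Y := by
      rw [hY]
      ring
    rw [hw, eY]
    congr 3
    rw [hX]
    congr 2
    linear_combination ((B 1 1 ^ 2 - B 1 0 ^ 2) * (Z 0 1 + Z 1 0) + 4 * B 1 0 * B 1 1 * Z 0 0) * hdet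
  have key := rotationDeriv_add_eq (Real.sinh t) (B 1 0) (B 1 1) (Z 0 0) (Z 0 1) (Z 1 0) hN hX hY
  rw [hw', frameMatrix, mul_smul_comm, ← mul_assoc, hb, ← smul_add, mul_assoc, ← mul_add,
    smul_mul_assoc _ (surfaceMatrix t * _), mul_assoc (surfaceMatrix t), adStar_lam, hZ1]
  congr 2
  rw [sub_neg_eq_add, ← two_mul, mul_neg, ← sub_eq_add_neg]
  exact key

/-! ### Equality of the connection forms on the total spaces -/

theorem leviCivita_apply {n : ℕ} (p : E n → FrameBundle) (hp : IsPlot p) (x v : E n) :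
    leviCivita.toFun p hp x v = (p x).frame⁻¹ * (fderiv ℝ (fun y => (p y).frame) x v +
      christoffelForm hypMetric ((p x).base : E 3) (fderiv ℝ (fun y => ((p y).base : E 3)) x v) *
        (p x).frame) := rfl

/-- On `SL(2, ℝ) × SU(2)`, the pull-back of the Levi-Civita connection is the 1-form that defines
the invariant connection. -/
theorem pullback_liftedFrame (t : ℝ) : (pulledLeviCivita t).pullback (liftedFrame t)
    (dSmooth_liftedFrame t) = (upForm (Real.sinh t)).map adStar := by
  refine OneForm.ext ?_
  funext n p hp x
  refine ContinuousLinearMap.ext fun v => ?_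
  have hA := contDiff_fst_of_isPlot hp
  have hU := contDiff_snd_of_isPlot hp
  have hA' := contDiff_matrix_iff.1 hA
  have hu := (Matrix.isUnit_iff_isUnit_det _).1
    ((adaptedFrame t (p x).1).act (Ad (QuotientGroup.mk (p x).2))).isUnit
  have key := fderiv_frameMatrix_add t hA x v
  have hF := (((contDiff_frameMatrix t (hA' 1 0) (hA' 1 1) fun y =>
    (p y).1.sq_add_sq_pos).differentiable (by simp)) x).hasFDerivAt
  have hM := (((contDiff_adMatrix hU).differentiable (by simp)) x).hasFDerivAt
  have hFM : fderiv ℝ (fun y => frameMatrix t ((p y).1 1 0) ((p y).1 1 1) * adMatrix (p y).2) x v =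
      frameMatrix t ((p x).1 1 0) ((p x).1 1 1) * fderiv ℝ (fun y => adMatrix (p y).2) x v +
        fderiv ℝ (fun y => frameMatrix t ((p y).1 1 0) ((p y).1 1 1)) x v * adMatrix (p x).2 :=
    congrArg (fun L => L v) (hF.mul' hM).fderiv
  change (frameMatrix t ((p x).1 1 0) ((p x).1 1 1) * adMatrix (p x).2)⁻¹ *
    (fderiv ℝ (fun y => frameMatrix t ((p y).1 1 0) ((p y).1 1 1) * adMatrix (p y).2) x v +
      christoffelForm hypMetric ((phi t ((p x).1 • UpperHalfPlane.I) : H3) : E 3)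
        (fderiv ℝ (fun y => ((phi t ((p y).1 • UpperHalfPlane.I) : H3) : E 3)) x v) *
      (frameMatrix t ((p x).1 1 0) ((p x).1 1 1) * adMatrix (p x).2)) =
    adStar ((upForm (Real.sinh t)).toFun p hp x v)
  change IsUnit (frameMatrix t ((p x).1 1 0) ((p x).1 1 1) * adMatrix (p x).2).det at hu
  -- Cancelling the inverse of the frame `F Ad(U)` leaves `d(F Ad(U)) + ΓF Ad(U) = F Ad(U) ad(U⁻¹λU
  -- + U⁻¹dU)`. The right side becomes `F ad(λ) Ad(U) + F d Ad(U)`, and `key` replaces `F ad(λ)` by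
  -- `dF + ΓF`.
  rw [← Matrix.nonsing_inv_mul_cancel_left _
    (adStar ((upForm (Real.sinh t)).toFun p hp x v)) hu]
  congr 1
  rw [upForm_apply, map_add, mul_add, mul_assoc, adMatrix_mul_adStar_conj _ (star_lam _ _),
    mul_assoc, ← fderiv_adMatrix hU, ← mul_assoc (frameMatrix _ _ _), ← key, hFM]
  noncomm_ring

/-- The value of a pull-back of the Levi-Civita connection at a point depends only on the germ of
the plot. -/
theorem leviCivita_congr {n : ℕ} {p p' : E n → FrameBundle} (hp : IsPlot p) (hp' : IsPlot p')
    {x : E n} (h : ∀ᶠ y in 𝓝 x, p y = p' y) :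
    leviCivita.toFun p hp x = leviCivita.toFun p' hp' x := by
  refine ContinuousLinearMap.ext fun v => ?_
  have hF : (fun y => (p y).frame) =ᶠ[𝓝 x] fun y => (p' y).frame := h.mono fun y hy => by
    dsimp only
    rw [hy]
  have hb : (fun y => ((p y).base : E 3)) =ᶠ[𝓝 x] fun y => ((p' y).base : E 3) :=
    h.mono fun y hy => by
      dsimp only
      rw [hy]
  rw [leviCivita_apply, leviCivita_apply, hF.fderiv_eq, hb.fderiv_eq, h.self_of_nhds]

/-- `homConnection` is evaluated on a plot of `P` through a chosen local lift. With that same lift,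
`pullback_liftedFrame` computes the right side; the left side is unaffected, because the two plots
of frames agree near the point. -/
theorem pullback_frameEquiv (t : ℝ) :
    (pulledLeviCivita t).pullback (frameEquiv t) (dSmooth_frameEquiv t) =
      (homConnection (Real.sinh t)).map adStar := by
  refine OneForm.ext ?_
  funext n p hp x
  have hq := (hp x).choose_spec.1
  have h := congrArg (fun η => η.toFun (hp x).choose hq x) (pullback_liftedFrame t)
  refine Eq.trans ?_ h
  refine leviCivita_congr (PulledFrames.dSmooth_point n _ (dSmooth_frameEquiv t n p hp))
    (PulledFrames.dSmooth_point n _ (dSmooth_liftedFrame t n _ hq)) ?_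
  filter_upwards [(hp x).choose_spec.2] with y hy
  rw [Function.comp_apply, Function.comp_apply, Function.comp_apply, Function.comp_apply,
    ← frameEquiv_quot, hy]

/-! ### The first two vectors of the frames -/

/-- The chain rule: a Möbius transformation of determinant one has derivative `1 / (ci + d)²` at
`i`, and `φ_t` is real linear in the real and imaginary parts. -/
theorem pushForward_mk (t : ℝ) (A : SL(2, ℝ)) (w : ℂ) :
    pushForward t (QuotientGroup.mk A) w =
      !₂[(w / (A 1 0 * Complex.I + A 1 1) ^ 2).im * Real.tanh t,
        (w / (A 1 0 * Complex.I + A 1 1) ^ 2).re,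
        (w / (A 1 0 * Complex.I + A 1 1) ^ 2).im / Real.cosh t] := by
  have hdet := A.det_coe
  rw [Matrix.det_fin_two] at hdet
  have hN := A.sq_add_sq_pos.ne'
  have hne : (A 1 0 : ℂ) * Complex.I + A 1 1 ≠ 0 := by
    intro h
    have h2 := congrArg Complex.re h
    have h3 := congrArg Complex.im h
    simp at h2 h3
    simp [h2, h3] at hN
  have hm : HasDerivAt (fun z : ℂ => ((A 0 0 : ℂ) * z + A 0 1) / ((A 1 0 : ℂ) * z + A 1 1))
      (1 / (A 1 0 * Complex.I + A 1 1) ^ 2) Complex.I := by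
    have h1 := (((hasDerivAt_id Complex.I).const_mul (A 0 0 : ℂ)).add_const (A 0 1 : ℂ)).div
      (((hasDerivAt_id Complex.I).const_mul (A 1 0 : ℂ)).add_const (A 1 1 : ℂ)) hne
    refine h1.congr_deriv ?_
    have hdet' : (A 0 0 : ℂ) * A 1 1 - A 0 1 * A 1 0 = 1 := by exact_mod_cast hdet
    simp only [id_eq, mul_one]
    rw [← hdet']
    congr 1
    ring
  have hm' := hm.hasFDerivAt.restrictScalars ℝ
  have hL : ∀ i : Fin 3, HasFDerivAt (fun z : ℂ =>
      (phi t (moebius (QuotientGroup.mk A) (UpperHalfPlane.ofComplex z)) : E 3) i)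
      ((![Real.tanh t • Complex.imCLM, Complex.reCLM, (Real.cosh t)⁻¹ • Complex.imCLM] i).comp
        ((ContinuousLinearMap.toSpanSingleton ℂ
          (1 / (A 1 0 * Complex.I + A 1 1 : ℂ) ^ 2)).restrictScalars ℝ)) Complex.I := by
    intro i
    refine ((![Real.tanh t • Complex.imCLM, Complex.reCLM, (Real.cosh t)⁻¹ • Complex.imCLM]
      i).hasFDerivAt.comp Complex.I hm').congr_of_eventuallyEq ?_
    -- `UpperHalfPlane.ofComplex` inverts the inclusion only on the half plane, so the rational
    -- formula is available only near `i`; the derivative needs no more.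
    have hpos : ∀ᶠ z : ℂ in 𝓝 Complex.I, 0 < z.im :=
      Complex.continuous_im.continuousAt.eventually (lt_mem_nhds (by simp))
    filter_upwards [hpos] with z hz
    have hz' : ((moebius (QuotientGroup.mk A) (UpperHalfPlane.ofComplex z) : UpperHalfPlane) : ℂ) =
        ((A 0 0 : ℂ) * z + A 0 1) / ((A 1 0 : ℂ) * z + A 1 1) := by
      change ((A • UpperHalfPlane.ofComplex z : UpperHalfPlane) : ℂ) = _
      rw [UpperHalfPlane.coe_specialLinearGroup_apply, UpperHalfPlane.ofComplex_apply_of_im_pos hz]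
      simp
    rw [phi_coe, ← UpperHalfPlane.coe_re, ← UpperHalfPlane.coe_im, hz']
    fin_cases i <;> simp [mul_comm, div_eq_mul_inv]
  have hd := (differentiableAt_euclidean.2 fun i => (hL i).differentiableAt).hasFDerivAt
  have hd' := fun i => (EuclideanSpace.proj (𝕜 := ℝ) (i : Fin 3)).hasFDerivAt.comp Complex.I hd
  ext i
  refine (congrArg (fun L => L w) ((hd' i).unique (hL i))).trans ?_
  fin_cases i <;> simp [mul_comm, div_eq_mul_inv]

theorem frameEquiv_mk_frame (t : ℝ) (g : PSL(2, ℝ)) (i : Fin 3) :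
    (frameEquiv t (P.mk g 1)).point.frame i 0 = (Real.cosh t)⁻¹ * pushForward t g 1 i ∧
      (frameEquiv t (P.mk g 1)).point.frame i 1 =
        (Real.cosh t)⁻¹ * pushForward t g Complex.I i := by
  induction g using QuotientGroup.induction_on with
  | H A =>
  have h1 : P.mk (QuotientGroup.mk A) 1 = P.quot (A, 1) := rfl
  have h2 : adMatrix 1 = 1 := by
    rw [← Ad_mk, QuotientGroup.mk_one, map_one]
    rfl
  rw [h1, frameEquiv_quot, liftedFrame_frame, h2, mul_one, pushForward_mk, pushForward_mk]
  have hN := A.sq_add_sq_pos.ne'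
  -- `m` is `1 / (ci + d)²` with real denominator, that is `(d - ic)² / (c² + d²)²`. Its parts are,
  -- up to the normalisation, the entries of `rotationMatrix`.
  obtain ⟨m, hm⟩ : ∃ m : ℂ, m = ((A 1 1 ^ 2 - A 1 0 ^ 2) / (A 1 0 ^ 2 + A 1 1 ^ 2) ^ 2 : ℝ) +
    (-2 * A 1 0 * A 1 1 / (A 1 0 ^ 2 + A 1 1 ^ 2) ^ 2 : ℝ) * Complex.I := ⟨_, rfl⟩
  have hmul : m * ((A 1 0 : ℂ) * Complex.I + A 1 1) ^ 2 = 1 := by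
    have hN' : (A 1 0 : ℂ) ^ 2 + (A 1 1 : ℂ) ^ 2 ≠ 0 := by exact_mod_cast hN
    have hsq : ((A 1 0 : ℂ) * Complex.I + A 1 1) * (A 1 1 - A 1 0 * Complex.I) =
        (A 1 0 : ℂ) ^ 2 + (A 1 1 : ℂ) ^ 2 := by
      linear_combination (-(A 1 0 : ℂ) ^ 2) * Complex.I_sq
    have hm' : m = (A 1 1 - A 1 0 * Complex.I) ^ 2 / ((A 1 0 : ℂ) ^ 2 + (A 1 1 : ℂ) ^ 2) ^ 2 := by
      rw [hm]
      push_cast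
      field_simp
      linear_combination (-(A 1 0 : ℂ) ^ 2) * Complex.I_sq
    rw [hm', div_mul_eq_mul_div, ← mul_pow, mul_comm (_ - _), hsq, div_self (pow_ne_zero 2 hN')]
  have hdiv : ∀ w : ℂ, w / ((A 1 0 : ℂ) * Complex.I + A 1 1) ^ 2 = w * m := fun w => by
    rw [div_eq_mul_inv, eq_inv_of_mul_eq_one_left hmul]
  have hre : m.re = (A 1 1 ^ 2 - A 1 0 ^ 2) / (A 1 0 ^ 2 + A 1 1 ^ 2) ^ 2 := by
    rw [hm, Complex.add_re, Complex.ofReal_re, Complex.re_ofReal_mul, Complex.I_re, mul_zero,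
      add_zero]
  have him : m.im = -2 * A 1 0 * A 1 1 / (A 1 0 ^ 2 + A 1 1 ^ 2) ^ 2 := by
    rw [hm, Complex.add_im, Complex.ofReal_im, Complex.im_ofReal_mul, Complex.I_im, mul_one,
      zero_add]
  have hch := (Real.cosh_pos t).ne'
  simp only [hdiv, one_mul, Complex.I_mul_re, Complex.I_mul_im, hre, him]
  constructor <;> fin_cases i <;>
    simp [frameMatrix, surfaceMatrix, rotationMatrix] <;> field_simp

end HypConn

end

/-! ### The isomorphism of pairs -/

theorem mainTheorem5 (t : ℝ) :
    ∃ (Φ : HypConn.P ≃ HypConn.PulledFrames t) (hΦ : DSmooth Φ),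
      DSmooth Φ.symm ∧
      (∀ y, (Φ y).base = y.proj) ∧
      (∀ y k, Φ (y.act k) = (Φ y).act (HypConn.Ad k)) ∧
      (HypConn.pulledLeviCivita t).pullback Φ hΦ =
        (HypConn.homConnection (Real.sinh t)).map HypConn.adStar ∧
      (∀ (g : PSL(2, ℝ)) (i : Fin 3),
        (Φ (HypConn.P.mk g 1)).point.frame i 0 =
            (Real.cosh t)⁻¹ * HypConn.pushForward t g 1 i ∧
          (Φ (HypConn.P.mk g 1)).point.frame i 1 =
            (Real.cosh t)⁻¹ * HypConn.pushForward t g Complex.I i) := by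
  exact ⟨HypConn.frameEquiv t, HypConn.dSmooth_frameEquiv t, HypConn.dSmooth_frameEquiv_symm t,
    HypConn.frameEquiv_base t, HypConn.frameEquiv_act t, HypConn.pullback_frameEquiv t,
    HypConn.frameEquiv_mk_frame t⟩
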